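/- All graphs are finite and simple. A forest is a graph without cycles and a tree is a connected forest. A fort of a graph $G$ is a nonempty set $F \subseteq V(G)$ such that every vertex of $V(G)\setminus F$ is adjacent to either zero or at least two vertices of $F$; a fort is minimal if no proper subset of it is a fort. Let $\mathcal{F}_{T_n}$ (respectively $\mathcal{F}_{R_n}$) denote the maximum number of minimal forts over all trees (respectively forests) on $n$ vertices. Let $T(19,4,4,2)$ be the rooted tree of height $2$ on $19$ vertices whose root has $4$ children, two of which have $4$ children each and two of which have $3$ children each. Then, for $1 \le n \le 19$, \[ \mathcal{F}_{T_n} = \begin{cases} 1 & \text{for } 1 \le n \le 3,\\ \binom{n-1}{2} & \text{for } 4 \le n \le 18,\\ 162 & \text{for } n = 19,\end{cases} \qquad \mathcal{F}_{R_n} = \begin{cases} n & \text{for } 1 \le n \le 4,\\ \binom{n-1}{2} & \text{for } 5 \le n \le 18,\\ 162 & \text{for } n = 19.\end{cases} \] Moreover, up to isomorphism, $T(19,4,4,2)$ is the unique tree on $19$ vertices with exactly $162$ minimal forts. -/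

import Mathlib

namespace MinimalForts

/-- A fort of `G`: a nonempty set `F` of vertices such that every vertex outside `F` is adjacent
to either zero or at least two vertices of `F`. -/
def IsFort {V : Type*} (G : SimpleGraph V) (F : Set V) : Prop :=
  F.Nonempty ∧
    ∀ v ∉ F, (G.neighborSet v ∩ F).encard = 0 ∨ 2 ≤ (G.neighborSet v ∩ F).encard

/-- A fort is minimal if no proper subset of it is a fort. -/
def IsMinimalFort {V : Type*} (G : SimpleGraph V) (F : Set V) : Prop :=
  IsFort G F ∧ ∀ F' : Set V, F' ⊂ F → ¬ IsFort G F'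

/-- The number of minimal forts of a finite graph `G`. -/
noncomputable def numMinimalForts {V : Type*} [Finite V] (G : SimpleGraph V) : ℕ :=
  {F : Set V | IsMinimalFort G F}.ncard

/-- The set of all values of the number of minimal forts over all trees on `n` vertices. -/
def treeFortCounts (n : ℕ) : Set ℕ :=
  {k | ∃ G : SimpleGraph (Fin n), G.IsTree ∧ numMinimalForts G = k}

/-- The set of all values of the number of minimal forts over all forests on `n` vertices. -/
def forestFortCounts (n : ℕ) : Set ℕ :=
  {k | ∃ G : SimpleGraph (Fin n), G.IsAcyclic ∧ numMinimalForts G = k}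

/-- The vertices of the rooted tree of height two whose root has `k` children, `p` of which have
`m - 1` children while the remaining `k - p` have `m` children. -/
inductive HeightTwoVertex (k m p : ℕ) : Type
  | root : HeightTwoVertex k m p
  | child (i : Fin k) : HeightTwoVertex k m p
  | leaf (i : Fin k) (j : Fin (if i.val < p then m - 1 else m)) : HeightTwoVertex k m p

/-- The tree `T(n, k, m, p)`, where `n = 1 + k + (k - p) m + p (m - 1)` is the number of its
vertices: the root is adjacent to its `k` children, and each of these to its own children. -/
def heightTwoTree (k m p : ℕ) : SimpleGraph (HeightTwoVertex k m p) :=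
  SimpleGraph.fromRel fun x y =>
    match x, y with
    | .root, .child _ => True
    | .child i, .leaf i' _ => i = i'
    | _, _ => False

end MinimalForts

/-! Cut a rooted tree at the edge to its last branch. The trace of a minimal fort on each side is
empty or has one of the four kinds in `Role`, and the kinds on the two sides determine the kind of
the whole. Conversely, a part that is not pending is a fort (`IsPart.spec`), such parts form an
antichain (`IsPart.eq_of_subset`), and every fort contains one (`exists_part_of_fortAwayFrom`).
Hence the minimal forts are exactly the free, matched and closed parts (`isMinimalFort_iff`).

The four numbers of parts form the profile of a rooted tree. The profile of `link a b` is given by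
polynomials with nonnegative coefficients in the profiles of `a` and `b` (`numParts_link`), so
linking is monotone (`Profile.link_ble_link`) and the maximum becomes a dynamic program over sizes:
a finite table of bounding profiles is certified by checking that it is closed under linking. The
pieces of the extremal tree are kept as actual trees, outside the table, which yields uniqueness
(`sorted_mem_exceptional_or_fits`). A nontrivial tree can be rooted at a leaf, so rooted trees with
at most 18 vertices suffice.

The bounds are attained by stars for `n ≤ 18`. In `T(19,4,4,2)` the root with one leaf from each
branch gives 3·3·4·4 = 144 minimal forts, and the pairs of sibling leaves give 2·3 + 2·6 = 18 more;
the total 162 exceeds the 153 of the star. A disconnected forest is split along a component, and the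
claimed maximum is superadditive. -/

open SimpleGraph

namespace MinimalForts

/-! ### Forts in first-order terms -/

section Isolation

variable {V W : Type*}

/-- The vertex `v` has no neighbor in `F`. -/
def HasNone (G : SimpleGraph V) (F : Set V) (v : V) : Prop := ∀ u, G.Adj v u → u ∉ F

/-- The vertex `v` has at least two neighbors in `F`. -/
def HasTwo (G : SimpleGraph V) (F : Set V) (v : V) : Prop :=
  ∃ u ∈ F, ∃ w ∈ F, u ≠ w ∧ G.Adj v u ∧ G.Adj v w

/-- Every vertex outside `F` other than `r` has zero or at least two neighbors in `F`. -/
def FortAwayFrom (G : SimpleGraph V) (r : V) (F : Set V) : Prop :=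
  ∀ v, v ≠ r → v ∉ F → HasNone G F v ∨ HasTwo G F v

theorem isFort_iff (G : SimpleGraph V) (F : Set V) :
    IsFort G F ↔ F.Nonempty ∧ ∀ v ∉ F, HasNone G F v ∨ HasTwo G F v := by
  have h0 (v : V) : (G.neighborSet v ∩ F).encard = 0 ↔ HasNone G F v := by
    simp only [Set.encard_eq_zero, Set.eq_empty_iff_forall_notMem, HasNone, Set.mem_inter_iff,
      mem_neighborSet, not_and]
  have h2 (v : V) : 2 ≤ (G.neighborSet v ∩ F).encard ↔ HasTwo G F v := by
    rw [← one_add_one_eq_two, ENat.add_one_le_iff (by simp), Set.one_lt_encard_iff]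
    simp only [HasTwo, Set.mem_inter_iff, mem_neighborSet]
    grind
  simp only [IsFort, h0, h2]

theorem isFort_iff_fortAwayFrom (G : SimpleGraph V) (r : V) (F : Set V) :
    IsFort G F ↔
      F.Nonempty ∧ FortAwayFrom G r F ∧ (r ∉ F → HasNone G F r ∨ HasTwo G F r) := by
  rw [isFort_iff]
  refine and_congr_right fun _ => ⟨fun h => ⟨fun v _ => h v, h r⟩, fun h v hv => ?_⟩
  by_cases hvr : v = r
  · subst hvr; exact h.2 hv
  · exact h.1 v hvr hv

theorem hasNone_empty (G : SimpleGraph V) (v : V) : HasNone G ∅ v := fun _ _ h => h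

theorem not_hasTwo_empty (G : SimpleGraph V) (v : V) : ¬ HasTwo G ∅ v := fun ⟨_, h, _⟩ => h

theorem HasTwo.not_hasNone {G : SimpleGraph V} {F : Set V} {v : V} (h : HasTwo G F v) :
    ¬ HasNone G F v := by
  obtain ⟨u, hu, _, _, _, ha, _⟩ := h
  exact fun hn => hn u ha hu

theorem fortAwayFrom_empty (G : SimpleGraph V) (r : V) : FortAwayFrom G r ∅ :=
  fun v _ _ => .inl (hasNone_empty G v)

/-! ### Joining two rooted graphs by an edge -/

/-- The disjoint union of two rooted graphs together with an edge between their roots. -/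
def join (G : SimpleGraph V) (r : V) (H : SimpleGraph W) (s : W) : SimpleGraph (V ⊕ W) :=
  (G ⊕g H) ⊔ edge (.inl r) (.inr s)

variable {G : SimpleGraph V} {r : V} {H : SimpleGraph W} {s : W}

@[simp] theorem join_adj_inl_inl (v v' : V) :
    (join G r H s).Adj (.inl v) (.inl v') ↔ G.Adj v v' := by
  simp [join, edge_adj]

@[simp] theorem join_adj_inr_inr (w w' : W) :
    (join G r H s).Adj (.inr w) (.inr w') ↔ H.Adj w w' := by
  simp [join, edge_adj]

@[simp] theorem join_adj_inl_inr (v : V) (w : W) :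
    (join G r H s).Adj (.inl v) (.inr w) ↔ v = r ∧ w = s := by
  simp [join, edge_adj]

@[simp] theorem join_adj_inr_inl (v : V) (w : W) :
    (join G r H s).Adj (.inr w) (.inl v) ↔ v = r ∧ w = s := by
  rw [adj_comm, join_adj_inl_inr]

theorem join_connected (hG : G.Connected) (hH : H.Connected) : (join G r H s).Connected :=
  hG.sum_sup_edge hH

theorem hasNone_join_inl (F : Set (V ⊕ W)) (v : V) :
    HasNone (join G r H s) F (.inl v) ↔
      HasNone G (Sum.inl ⁻¹' F) v ∧ (v = r → s ∉ (Sum.inr ⁻¹' F : Set W)) := by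
  simp only [HasNone, Sum.forall, join_adj_inl_inl, join_adj_inl_inr, Set.mem_preimage]
  grind

theorem hasNone_join_inr (F : Set (V ⊕ W)) (w : W) :
    HasNone (join G r H s) F (.inr w) ↔
      HasNone H (Sum.inr ⁻¹' F) w ∧ (w = s → r ∉ (Sum.inl ⁻¹' F : Set V)) := by
  simp only [HasNone, Sum.forall, join_adj_inr_inr, join_adj_inr_inl, Set.mem_preimage]
  grind

theorem hasTwo_join_inl (F : Set (V ⊕ W)) (v : V) :
    HasTwo (join G r H s) F (.inl v) ↔ HasTwo G (Sum.inl ⁻¹' F) v ∨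
      (v = r ∧ s ∈ (Sum.inr ⁻¹' F : Set W) ∧ ¬ HasNone G (Sum.inl ⁻¹' F) v) := by
  simp only [HasTwo, HasNone, Sum.exists, join_adj_inl_inl, join_adj_inl_inr, Set.mem_preimage,
    not_forall, not_not]
  grind

theorem hasTwo_join_inr (F : Set (V ⊕ W)) (w : W) :
    HasTwo (join G r H s) F (.inr w) ↔ HasTwo H (Sum.inr ⁻¹' F) w ∨
      (w = s ∧ r ∈ (Sum.inl ⁻¹' F : Set V) ∧ ¬ HasNone H (Sum.inr ⁻¹' F) w) := by
  simp only [HasTwo, HasNone, Sum.exists, join_adj_inr_inr, join_adj_inr_inl, Set.mem_preimage,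
    not_forall, not_not]
  grind

/-- Apart from the exempted `r`, only `s` gains a neighbor. The last clause is the fort condition at
`s` with the extra neighbor `r` counted: `r` may be the second neighbor in `F`, but not the only
one. -/
theorem fortAwayFrom_join (F : Set (V ⊕ W)) :
    FortAwayFrom (join G r H s) (.inl r) F ↔
      FortAwayFrom G r (Sum.inl ⁻¹' F) ∧ FortAwayFrom H s (Sum.inr ⁻¹' F) ∧
      (s ∉ (Sum.inr ⁻¹' F : Set W) →
        (HasNone H (Sum.inr ⁻¹' F) s ∧ r ∉ (Sum.inl ⁻¹' F : Set V)) ∨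
        HasTwo H (Sum.inr ⁻¹' F) s ∨
        (r ∈ (Sum.inl ⁻¹' F : Set V) ∧ ¬ HasNone H (Sum.inr ⁻¹' F) s)) := by
  simp only [FortAwayFrom, Sum.forall, hasNone_join_inl, hasTwo_join_inl, hasNone_join_inr,
    hasTwo_join_inr, Set.mem_preimage]
  constructor
  · rintro ⟨h1, h2⟩
    refine ⟨?_, ?_, ?_⟩
    · grind
    · grind
    · intro hs; have := h2 s; grind
  · rintro ⟨h1, h2, h3⟩
    refine ⟨by grind, fun w _ hw => ?_⟩
    by_cases hws : w = s
    · subst hws; grind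
    · have := h2 w hws hw; grind

end Isolation

/-! ### Rooted trees -/

/-- Plane rooted trees: `link a b` attaches the root of `b` as a new child to the root of `a`. -/
inductive RTree : Type
  | single : RTree
  | link : RTree → RTree → RTree
  deriving DecidableEq

namespace RTree

/-- The vertices of a rooted tree. -/
def Vert : RTree → Type
  | single => Unit
  | link a b => Vert a ⊕ Vert b

/-- The root of a rooted tree. -/
def root : (t : RTree) → t.Vert
  | single => ()
  | link a _ => .inl a.root

/-- The underlying graph of a rooted tree. -/
def graph : (t : RTree) → SimpleGraph t.Vert
  | single => ⊥
  | link a b => join a.graph a.root b.graph b.root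

/-- The number of vertices of a rooted tree. -/
def size : RTree → ℕ
  | single => 1
  | link a b => a.size + b.size

instance finite_vert : (t : RTree) → Finite t.Vert
  | single => inferInstanceAs (Finite Unit)
  | link a b =>
    have := finite_vert a
    have := finite_vert b
    inferInstanceAs (Finite (a.Vert ⊕ b.Vert))

theorem card_vert (t : RTree) : Nat.card t.Vert = t.size := by
  induction t with
  | single => exact Nat.card_unique (α := Unit)
  | link a b iha ihb =>
    exact (Nat.card_sum (α := a.Vert) (β := b.Vert)).trans (by rw [iha, ihb, size])

/-- The part of a set of vertices of `link a b` that lies in `a`. -/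
def left {a b : RTree} (F : Set (link a b).Vert) : Set a.Vert :=
  Sum.inl ⁻¹' (F : Set (a.Vert ⊕ b.Vert))

/-- The part of a set of vertices of `link a b` that lies in `b`. -/
def right {a b : RTree} (F : Set (link a b).Vert) : Set b.Vert :=
  Sum.inr ⁻¹' (F : Set (a.Vert ⊕ b.Vert))

section Link

variable {a b : RTree} (F : Set (link a b).Vert)

theorem root_mem_link : (link a b).root ∈ F ↔ a.root ∈ left F := Iff.rfl

theorem nonempty_link : F.Nonempty ↔ (left F).Nonempty ∨ (right F).Nonempty :=
  ⟨fun ⟨v, hv⟩ => v.casesOn (motive := fun v => v ∈ F → _) (fun x hx => .inl ⟨x, hx⟩)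
    (fun x hx => .inr ⟨x, hx⟩) hv, fun h => h.elim (fun ⟨x, hx⟩ => ⟨.inl x, hx⟩)
    (fun ⟨x, hx⟩ => ⟨.inr x, hx⟩)⟩

theorem hasNone_link : HasNone (link a b).graph F (link a b).root ↔
    HasNone a.graph (left F) a.root ∧ b.root ∉ right F :=
  (hasNone_join_inl (G := a.graph) (H := b.graph) (s := b.root) F a.root).trans
    (by simp [left, right])

theorem hasTwo_link : HasTwo (link a b).graph F (link a b).root ↔
    HasTwo a.graph (left F) a.root ∨ (b.root ∈ right F ∧ ¬ HasNone a.graph (left F) a.root) :=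
  (hasTwo_join_inl (G := a.graph) (H := b.graph) (s := b.root) F a.root).trans
    (by simp [left, right])

theorem fortAwayFrom_link : FortAwayFrom (link a b).graph (link a b).root F ↔
    FortAwayFrom a.graph a.root (left F) ∧ FortAwayFrom b.graph b.root (right F) ∧
      (b.root ∉ right F → (HasNone b.graph (right F) b.root ∧ a.root ∉ left F) ∨
        HasTwo b.graph (right F) b.root ∨
        (a.root ∈ left F ∧ ¬ HasNone b.graph (right F) b.root)) :=
  fortAwayFrom_join (G := a.graph) (r := a.root) (H := b.graph) (s := b.root) F

/-- The set of vertices of `link a b` with given parts in `a` and in `b`. -/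
def glue (F₁ : Set a.Vert) (F₂ : Set b.Vert) : Set (link a b).Vert :=
  {v : a.Vert ⊕ b.Vert | Sum.elim (· ∈ F₁) (· ∈ F₂) v}

@[simp] theorem left_glue (F₁ : Set a.Vert) (F₂ : Set b.Vert) : left (glue F₁ F₂) = F₁ := rfl

@[simp] theorem right_glue (F₁ : Set a.Vert) (F₂ : Set b.Vert) : right (glue F₁ F₂) = F₂ := rfl

theorem subset_link {F F' : Set (link a b).Vert} :
    F' ⊆ F ↔ left F' ⊆ left F ∧ right F' ⊆ right F :=
  ⟨fun h => ⟨fun _ hx => h hx, fun _ hx => h hx⟩, fun h v => Sum.casesOn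
    (motive := fun v => v ∈ (F' : Set (a.Vert ⊕ b.Vert)) → v ∈ (F : Set (a.Vert ⊕ b.Vert)))
    v (fun _ hx => h.1 hx) (fun _ hx => h.2 hx)⟩

theorem ext_link {F F' : Set (link a b).Vert} (h₁ : left F' = left F) (h₂ : right F' = right F) :
    F' = F :=
  (subset_link.2 ⟨h₁.le, h₂.le⟩).antisymm (subset_link.2 ⟨h₁.ge, h₂.ge⟩)

end Link

/-! ### Traces of minimal forts and their roles -/

/-- The roles of a set `F` of vertices of a rooted tree that is the trace of a minimal fort:
the root is in `F` and has no child in `F` (`free`) or one child in `F` (`matched`), or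
the root is not in `F`, has one child in `F`, and its parent is needed in `F` (`pending`), or `F`
is a fort which avoids the root (`closed`). -/
inductive Role : Type
  | free | matched | pending | closed

/-- The sets of vertices which play a given role. -/
def IsPart : (t : RTree) → Role → Set t.Vert → Prop
  | single, .free, F => () ∈ F
  | single, _, _ => False
  | link a b, .free, F => IsPart a .free (left F) ∧ IsPart b .pending (right F)
  | link a b, .matched, F =>
    (IsPart a .matched (left F) ∧ IsPart b .pending (right F)) ∨
    (IsPart a .free (left F) ∧ IsPart b .free (right F))
  | link a b, .pending, F =>
    (IsPart a .pending (left F) ∧ right F = ∅) ∨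
    (left F = ∅ ∧
      (IsPart b .free (right F) ∨ IsPart b .matched (right F)))
  | link a b, .closed, F =>
    (IsPart a .closed (left F) ∧ right F = ∅) ∨
    (left F = ∅ ∧ IsPart b .closed (right F)) ∨
    (IsPart a .pending (left F) ∧
      (IsPart b .free (right F) ∨ IsPart b .matched (right F)))

/-- What a set that plays a given role looks like near the root. -/
def RootSpec (t : RTree) (F : Set t.Vert) : Role → Prop
  | .free => t.root ∈ F
  | .matched => t.root ∈ F
  | .pending => t.root ∉ F ∧ ¬ HasNone t.graph F t.root ∧ ¬ HasTwo t.graph F t.root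
  | .closed => t.root ∉ F ∧ (HasNone t.graph F t.root ∨ HasTwo t.graph F t.root)

/-- Soundness of the recursive definition of parts. The new edge affects only the two roots, so the
induction needs no more about each side than what `RootSpec` records. -/
theorem IsPart.spec {t : RTree} {X : Role} {F : Set t.Vert} (h : IsPart t X F) :
    F.Nonempty ∧ FortAwayFrom t.graph t.root F ∧ RootSpec t F X := by
  induction t generalizing X with
  | single =>
    cases X <;> simp only [IsPart] at h
    exact ⟨⟨_, h⟩, fun v hv => absurd rfl hv, h⟩
  | link a b iha ihb =>
    have e1 := fortAwayFrom_empty a.graph a.root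
    have e2 := fortAwayFrom_empty b.graph b.root
    have n1 := hasNone_empty a.graph a.root
    have n2 := hasNone_empty b.graph b.root
    have m1 := not_hasTwo_empty a.graph a.root
    have m2 := not_hasTwo_empty b.graph b.root
    have t1 := HasTwo.not_hasNone (G := a.graph) (F := left F) (v := a.root)
    have t2 := HasTwo.not_hasNone (G := b.graph) (F := right F) (v := b.root)
    have q1 : a.root ∉ (∅ : Set a.Vert) := id
    have q2 : b.root ∉ (∅ : Set b.Vert) := id
    rw [nonempty_link, fortAwayFrom_link]
    cases X <;> simp only [IsPart] at h <;>
      simp only [RootSpec, root_mem_link, hasNone_link, hasTwo_link]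
    · have A1 := iha h.1
      have C2 := ihb h.2
      simp only [RootSpec] at A1 C2
      grind only
    · rcases h with ⟨h1, h2⟩ | ⟨h1, h2⟩ <;>
      · have A1 := iha h1
        have C2 := ihb h2
        simp only [RootSpec] at A1 C2
        grind only
    · rcases h with ⟨h1, h2⟩ | ⟨h1, h2 | h2⟩
      · have A1 := iha h1
        simp only [RootSpec] at A1
        rw [h2]
        grind only
      all_goals
        have A1 := ihb h2
        simp only [RootSpec] at A1
        rw [h1]
        grind only
    · rcases h with ⟨h1, h2⟩ | ⟨h1, h2⟩ | ⟨h1, h2 | h2⟩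
      · have A1 := iha h1
        simp only [RootSpec] at A1
        rw [h2]
        grind only
      · have A1 := ihb h2
        simp only [RootSpec] at A1
        rw [h1]
        grind only
      all_goals
        have A1 := iha h1
        have A2 := ihb h2
        simp only [RootSpec] at A1 A2
        grind only

/-- Parts with different roles, except for a pending part inside a matched or a closed one, are
incomparable, and so are different parts with the same role. -/
theorem IsPart.eq_of_subset {t : RTree} {X Y : Role} {F' F : Set t.Vert} (h' : IsPart t X F')
    (h : IsPart t Y F) (hs : F' ⊆ F) (hXY : X = .pending → Y = .free ∨ Y = .pending) :
    X = Y ∧ F' = F := by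
  induction t generalizing X Y with
  | single =>
    cases X <;> cases Y <;> simp only [IsPart] at h h'
    exact ⟨rfl, Set.ext fun _ => iff_of_true h' h⟩
  | link a b iha ihb =>
    rw [subset_link] at hs
    suffices X = Y ∧ left F' = left F ∧ right F' = right F from
      ⟨this.1, ext_link this.2.1 this.2.2⟩
    have na (X) (h : IsPart a X (left F')) := h.spec.1
    have nb (X) (h : IsPart b X (right F')) := h.spec.1
    have fa (h : IsPart a .free (left F')) : a.root ∈ left F := hs.1 h.spec.2.2
    have fb (h : IsPart b .free (right F')) : b.root ∈ right F := hs.2 h.spec.2.2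
    have ma (h : IsPart a .matched (left F')) : a.root ∈ left F := hs.1 h.spec.2.2
    have mb (h : IsPart b .matched (right F')) : b.root ∈ right F := hs.2 h.spec.2.2
    have pa (h : IsPart a .pending (left F)) : a.root ∉ left F := h.spec.2.2.1
    have pb (h : IsPart b .pending (right F)) : b.root ∉ right F := h.spec.2.2.1
    have ca (h : IsPart a .closed (left F)) : a.root ∉ left F := h.spec.2.2.1
    have cb (h : IsPart b .closed (right F)) : b.root ∉ right F := h.spec.2.2.1
    have e1 (h : left F = ∅) : left F' = ∅ := Set.subset_empty_iff.1 (h ▸ hs.1)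
    have e2 (h : right F = ∅) : right F' = ∅ := Set.subset_empty_iff.1 (h ▸ hs.2)
    have ia (X Y) (h' : IsPart a X (left F')) (h : IsPart a Y (left F)) := iha h' h hs.1
    have ib (X Y) (h' : IsPart b X (right F')) (h : IsPart b Y (right F)) := ihb h' h hs.2
    simp only [Set.nonempty_iff_ne_empty] at na nb
    clear iha ihb hs
    cases X <;> cases Y <;> simp only [IsPart] at h h' <;> grind only

/-- The root of a matched part can be removed, which leaves a pending part. -/
theorem IsPart.exists_pending {t : RTree} {F : Set t.Vert} (h : IsPart t .matched F) :
    ∃ F' ⊆ F, IsPart t .pending F' := by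
  induction t with
  | single => exact h.elim
  | link a b iha ihb =>
    rcases h with ⟨h1, -⟩ | ⟨-, h2⟩
    · obtain ⟨F', hF, hp⟩ := iha h1
      exact ⟨glue F' ∅, subset_link.2 ⟨hF, Set.empty_subset _⟩, .inl ⟨hp, rfl⟩⟩
    · exact ⟨glue ∅ (right F), subset_link.2 ⟨Set.empty_subset _, subset_rfl⟩,
        .inr ⟨rfl, .inl h2⟩⟩

/-- `F` contains a part with the role `X`. -/
def ContainsPart (t : RTree) (X : Role) (F : Set t.Vert) : Prop := ∃ F' ⊆ F, IsPart t X F'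

section Contains

variable {a b : RTree} {F : Set (link a b).Vert}

theorem containsPart_link {X : Role} {F₁ : Set a.Vert} {F₂ : Set b.Vert} (h₁ : F₁ ⊆ left F)
    (h₂ : F₂ ⊆ right F) (h : IsPart (link a b) X (glue F₁ F₂)) : ContainsPart (link a b) X F :=
  ⟨glue F₁ F₂, subset_link.2 ⟨h₁, h₂⟩, h⟩

theorem containsPart_free (h₁ : ContainsPart a .free (left F))
    (h₂ : ContainsPart b .pending (right F)) : ContainsPart (link a b) .free F := by
  obtain ⟨F₁, s₁, p₁⟩ := h₁
  obtain ⟨F₂, s₂, p₂⟩ := h₂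
  exact containsPart_link s₁ s₂ ⟨p₁, p₂⟩

theorem containsPart_matched₁ (h₁ : ContainsPart a .matched (left F))
    (h₂ : ContainsPart b .pending (right F)) : ContainsPart (link a b) .matched F := by
  obtain ⟨F₁, s₁, p₁⟩ := h₁
  obtain ⟨F₂, s₂, p₂⟩ := h₂
  exact containsPart_link s₁ s₂ (.inl ⟨p₁, p₂⟩)

theorem containsPart_matched₂ (h₁ : ContainsPart a .free (left F))
    (h₂ : ContainsPart b .free (right F)) : ContainsPart (link a b) .matched F := by
  obtain ⟨F₁, s₁, p₁⟩ := h₁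
  obtain ⟨F₂, s₂, p₂⟩ := h₂
  exact containsPart_link s₁ s₂ (.inr ⟨p₁, p₂⟩)

theorem containsPart_pending₁ (h₁ : ContainsPart a .pending (left F)) :
    ContainsPart (link a b) .pending F := by
  obtain ⟨F₁, s₁, p₁⟩ := h₁
  exact containsPart_link s₁ (Set.empty_subset _) (.inl ⟨p₁, rfl⟩)

theorem containsPart_pending₂
    (h₂ : ContainsPart b .free (right F) ∨ ContainsPart b .matched (right F)) :
    ContainsPart (link a b) .pending F := by
  rcases h₂ with ⟨F₂, s₂, p₂⟩ | ⟨F₂, s₂, p₂⟩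
  · exact containsPart_link (Set.empty_subset _) s₂ (.inr ⟨rfl, .inl p₂⟩)
  · exact containsPart_link (Set.empty_subset _) s₂ (.inr ⟨rfl, .inr p₂⟩)

theorem containsPart_closed₁ (h₁ : ContainsPart a .closed (left F)) :
    ContainsPart (link a b) .closed F := by
  obtain ⟨F₁, s₁, p₁⟩ := h₁
  exact containsPart_link s₁ (Set.empty_subset _) (.inl ⟨p₁, rfl⟩)

theorem containsPart_closed₂ (h₂ : ContainsPart b .closed (right F)) :
    ContainsPart (link a b) .closed F := by
  obtain ⟨F₂, s₂, p₂⟩ := h₂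
  exact containsPart_link (Set.empty_subset _) s₂ (.inr (.inl ⟨rfl, p₂⟩))

theorem containsPart_closed₃ (h₁ : ContainsPart a .pending (left F))
    (h₂ : ContainsPart b .free (right F) ∨ ContainsPart b .matched (right F)) :
    ContainsPart (link a b) .closed F := by
  obtain ⟨F₁, s₁, p₁⟩ := h₁
  rcases h₂ with ⟨F₂, s₂, p₂⟩ | ⟨F₂, s₂, p₂⟩
  · exact containsPart_link s₁ s₂ (.inr (.inr ⟨p₁, .inl p₂⟩))
  · exact containsPart_link s₁ s₂ (.inr (.inr ⟨p₁, .inr p₂⟩))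

end Contains

theorem ContainsPart.pending {t : RTree} {F : Set t.Vert} (h : ContainsPart t .matched F) :
    ContainsPart t .pending F := by
  obtain ⟨F', s, p⟩ := h
  obtain ⟨F'', s', p'⟩ := p.exists_pending
  exact ⟨F'', s'.trans s, p'⟩

/-- A set that satisfies the condition on forts away from the root contains a part whose role
depends on the number of neighbors of the root in it. -/
theorem exists_part_of_fortAwayFrom {t : RTree} {F : Set t.Vert}
    (h : FortAwayFrom t.graph t.root F) :
    (t.root ∈ F →
      ContainsPart t .free F ∨ ContainsPart t .matched F ∨ ContainsPart t .closed F) ∧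
    (F.Nonempty → t.root ∉ F → HasNone t.graph F t.root → ContainsPart t .closed F) ∧
    (t.root ∉ F → HasTwo t.graph F t.root → ContainsPart t .closed F) ∧
    (t.root ∉ F → ¬ HasNone t.graph F t.root →
      ContainsPart t .pending F ∨ ContainsPart t .closed F) := by
  induction t with
  | single =>
    refine ⟨fun h => .inl ⟨F, subset_rfl, h⟩, fun ⟨_, h⟩ h' => (h' h).elim, ?_, ?_⟩
    · rintro h ⟨_, hu, _⟩
      exact (h hu).elim
    · exact fun _ h => (h fun _ h => h.elim).elim
  | link a b iha ihb =>
    rw [fortAwayFrom_link] at h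
    obtain ⟨h1, h2, h3⟩ := h
    obtain ⟨a1, a2, a3, a4⟩ := iha h1
    obtain ⟨b1, b2, b3, b4⟩ := ihb h2
    simp only [root_mem_link, hasNone_link, hasTwo_link, nonempty_link]
    have t1 := HasTwo.not_hasNone (G := a.graph) (F := left F) (v := a.root)
    have t2 := HasTwo.not_hasNone (G := b.graph) (F := right F) (v := b.root)
    have c0 := @containsPart_free a b F
    have c1 := @containsPart_matched₁ a b F
    have c2 := @containsPart_matched₂ a b F
    have c3 := @containsPart_pending₁ a b F
    have c4 := @containsPart_pending₂ a b F
    have c5 := @containsPart_closed₁ a b F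
    have c6 := @containsPart_closed₂ a b F
    have c7 := @containsPart_closed₃ a b F
    -- If the parts found in `a` and in `b` both contain their roots and one of them is matched, its
    -- root is superfluous: a pending part replaces it. This gives a closed part if the root of `a`
    -- is dropped, and a free one if a matched root of `b` is dropped beside a free part of `a`.
    have d1 := @ContainsPart.pending a (left F)
    have d2 := @ContainsPart.pending b (right F)
    clear iha ihb
    refine ⟨?_, ?_, ?_, ?_⟩ <;> grind only

/-- The minimal forts of a tree are its parts which need no parent. -/
theorem isMinimalFort_iff (t : RTree) (F : Set t.Vert) :
    IsMinimalFort t.graph F ↔ IsPart t .free F ∨ IsPart t .matched F ∨ IsPart t .closed F := by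
  have fort (X : Role) (hX : X ≠ .pending) (F) (h : IsPart t X F) : IsFort t.graph F := by
    rw [isFort_iff_fortAwayFrom _ t.root]
    have := h.spec
    cases X <;> simp only [RootSpec] at this <;> grind only
  have sub (F) (h : IsFort t.graph F) : ∃ X, X ≠ .pending ∧ ContainsPart t X F := by
    rw [isFort_iff_fortAwayFrom _ t.root] at h
    have := exists_part_of_fortAwayFrom h.2.1
    grind only
  have key : IsMinimalFort t.graph F ↔ ∃ X, X ≠ .pending ∧ IsPart t X F := by
    constructor
    · rintro ⟨hF, hmin⟩
      obtain ⟨X, hX, F', hs, hp⟩ := sub F hF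
      rcases hs.eq_or_ssubset with rfl | hs
      · exact ⟨X, hX, hp⟩
      · exact (hmin F' hs (fort X hX F' hp)).elim
    · rintro ⟨X, hX, hp⟩
      refine ⟨fort X hX F hp, fun F' hs hF' => ?_⟩
      obtain ⟨Y, hY, F'', hs', hp'⟩ := sub F' hF'
      have := (hp'.eq_of_subset hp (hs'.trans hs.1) (by simp [hY])).2
      exact hs.2 (this ▸ hs')
  rw [key]
  constructor
  · rintro ⟨X, hX, hp⟩
    cases X <;> grind only
  · rintro (h | h | h) <;> exact ⟨_, by simp, h⟩

/-! ### Counting the parts -/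

/-- The numbers of sets of vertices that play the roles free, matched, pending and closed. -/
@[ext] structure Profile where
  free : ℕ
  matched : ℕ
  pending : ℕ
  closed : ℕ

/-- The profile of `link a b`, given those of `a` and `b`. -/
def Profile.link (x y : Profile) : Profile where
  free := x.free * y.pending
  matched := x.matched * y.pending + x.free * y.free
  pending := x.pending + (y.free + y.matched)
  closed := x.closed + y.closed + x.pending * (y.free + y.matched)

/-- The profile of a rooted tree. -/
def profile : RTree → Profile
  | single => ⟨1, 0, 0, 0⟩
  | link a b => a.profile.link b.profile

/-- The number of sets of vertices that play a given role. -/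
noncomputable def numParts (t : RTree) (X : Role) : ℕ := {F | IsPart t X F}.ncard

theorem ncard_link {a b : RTree} (P : Set a.Vert → Prop) (Q : Set b.Vert → Prop) :
    {F : Set (link a b).Vert | P (left F) ∧ Q (right F)}.ncard =
      {F | P F}.ncard * {F | Q F}.ncard := by
  rw [← Set.ncard_prod, ← Set.ncard_image_of_injective (f := fun F => (left F, right F))]
  · congr 1
    ext ⟨F₁, F₂⟩
    constructor
    · rintro ⟨F, h, h'⟩
      cases h'
      exact h
    · exact fun h => ⟨glue F₁ F₂, h, rfl⟩
  · exact fun F F' h => ext_link (congrArg Prod.fst h) (congrArg Prod.snd h)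

theorem ncard_or {t : RTree} {P Q : Set t.Vert → Prop} (h : ∀ F, P F → ¬ Q F) :
    {F | P F ∨ Q F}.ncard = {F | P F}.ncard + {F | Q F}.ncard :=
  Set.ncard_union_eq (Set.disjoint_left.2 h) (Set.toFinite _) (Set.toFinite _)

theorem IsPart.role_unique {t : RTree} {X Y : Role} {F : Set t.Vert} (h : IsPart t X F)
    (h' : IsPart t Y F) : X = Y := by
  -- `eq_of_subset` restricts pending parts only on the smaller side. As the two sets are equal, a
  -- part that is not pending can be taken as the smaller one.
  by_cases hX : X = .pending
  · by_cases hY : Y = .pending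
    · rw [hX, hY]
    · exact ((h'.eq_of_subset h subset_rfl) (by simp [hY])).1.symm
  · exact ((h.eq_of_subset h' subset_rfl) (by simp [hX])).1

theorem numParts_free_or_matched (t : RTree) :
    {F | IsPart t .free F ∨ IsPart t .matched F}.ncard =
      numParts t .free + numParts t .matched :=
  ncard_or fun _ h h' => by cases h.role_unique h'

/-- A set of vertices of `link a b` is a pair of traces, so conjunctions count as products. The
alternatives in `IsPart` exclude each other, because parts are nonempty and have only one role, so
disjunctions count as sums. -/
theorem numParts_link (a b : RTree) :
    numParts (link a b) .free = numParts a .free * numParts b .pending ∧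
    numParts (link a b) .matched =
      numParts a .matched * numParts b .pending + numParts a .free * numParts b .free ∧
    numParts (link a b) .pending =
      numParts a .pending + (numParts b .free + numParts b .matched) ∧
    numParts (link a b) .closed = numParts a .closed + numParts b .closed +
      numParts a .pending * (numParts b .free + numParts b .matched) := by
  have e (t : RTree) : {F : Set t.Vert | F = ∅}.ncard = 1 := Set.ncard_singleton _
  refine ⟨ncard_link (IsPart a .free) (IsPart b .pending), ?_, ?_, ?_⟩
  · have h := @ncard_or (link a b)
      (fun F => IsPart a .matched (left F) ∧ IsPart b .pending (right F))
      (fun F => IsPart a .free (left F) ∧ IsPart b .free (right F))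
      (by rintro F ⟨h1, -⟩ ⟨h2, -⟩; cases h1.role_unique h2)
    rwa [ncard_link, ncard_link] at h
  · have h := @ncard_or (link a b)
      (fun F => IsPart a .pending (left F) ∧ right F = ∅)
      (fun F => left F = ∅ ∧ (IsPart b .free (right F) ∨ IsPart b .matched (right F)))
      (by rintro F ⟨h1, -⟩ ⟨h2, -⟩; exact h1.spec.1.ne_empty h2)
    rwa [ncard_link (IsPart a .pending) (· = ∅),
      ncard_link (· = ∅) (fun F => IsPart b .free F ∨ IsPart b .matched F), e, e, mul_one,
      one_mul, numParts_free_or_matched] at h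
  · have h := @ncard_or (link a b)
      (fun F => left F = ∅ ∧ IsPart b .closed (right F))
      (fun F => IsPart a .pending (left F) ∧
        (IsPart b .free (right F) ∨ IsPart b .matched (right F)))
      (by rintro F ⟨h1, -⟩ ⟨h2, -⟩; exact h2.spec.1.ne_empty h1)
    have h' := @ncard_or (link a b)
      (fun F => IsPart a .closed (left F) ∧ right F = ∅)
      (fun F => (left F = ∅ ∧ IsPart b .closed (right F)) ∨
        (IsPart a .pending (left F) ∧ (IsPart b .free (right F) ∨ IsPart b .matched (right F))))
      (by
        rintro F ⟨h1, h1'⟩ (⟨h2, -⟩ | ⟨h2, h2'⟩)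
        · exact h1.spec.1.ne_empty h2
        · cases h1.role_unique h2)
    rwa [h, ncard_link (IsPart a .closed) (· = ∅), ncard_link (· = ∅) (IsPart b .closed),
      ncard_link (IsPart a .pending) (fun F => IsPart b .free F ∨ IsPart b .matched F), e, e,
      mul_one, one_mul, numParts_free_or_matched, ← add_assoc] at h'

theorem profile_eq (t : RTree) : t.profile = ⟨numParts t .free, numParts t .matched,
    numParts t .pending, numParts t .closed⟩ := by
  induction t with
  | single =>
    have h : numParts single .free = 1 := by
      rw [numParts, Set.ncard_eq_one]
      refine ⟨Set.univ, Set.ext fun F => ⟨fun h => Set.eq_univ_of_forall fun _ => h, fun h => ?_⟩⟩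
      rw [Set.mem_singleton_iff.1 h]
      exact Set.mem_univ ()
    have h' (X : Role) (hX : X ≠ .free) : numParts single X = 0 := by
      rw [numParts, Set.ncard_eq_zero]
      refine Set.eq_empty_of_forall_notMem fun F hF => ?_
      cases X <;> first | exact hX rfl | exact hF
    rw [h, h' _ (by simp), h' _ (by simp), h' _ (by simp), profile]
  | link a b iha ihb =>
    obtain ⟨h1, h2, h3, h4⟩ := numParts_link a b
    rw [profile, iha, ihb, h1, h2, h3, h4, Profile.link]

theorem numMinimalForts_graph (t : RTree) :
    numMinimalForts t.graph = t.profile.free + t.profile.matched + t.profile.closed := by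
  simp only [numMinimalForts, isMinimalFort_iff, profile_eq, add_assoc]
  rw [ncard_or, ncard_or, numParts, numParts, numParts]
  · exact fun _ h h' => by cases h.role_unique h'
  · rintro _ h (h' | h') <;> cases h.role_unique h'

end RTree

/-! ### Isomorphisms -/

section Iso

variable {V W V' W' X : Type*} {G : SimpleGraph V} {H : SimpleGraph W} {G' : SimpleGraph V'}
  {H' : SimpleGraph W'} {K : SimpleGraph X} {r : V} {s : W} {r' : V'} {s' : W'} {x : X}

theorem isFort_iso_iff (e : G ≃g G') (F : Set V') : IsFort G (e ⁻¹' F) ↔ IsFort G' F := by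
  have h0 (v : V) : HasNone G (e ⁻¹' F) v ↔ HasNone G' F (e v) := by
    simp only [HasNone, e.surjective.forall, e.map_adj_iff, Set.mem_preimage]
  have h2 (v : V) : HasTwo G (e ⁻¹' F) v ↔ HasTwo G' F (e v) := by
    simp only [HasTwo, e.surjective.exists, e.map_adj_iff, Set.mem_preimage, ne_eq,
      e.injective.eq_iff]
  simp only [isFort_iff, e.surjective.forall, h0, h2, Set.mem_preimage, Set.Nonempty,
    e.surjective.exists]

theorem isMinimalFort_iso_iff (e : G ≃g G') (F : Set V') :
    IsMinimalFort G (e ⁻¹' F) ↔ IsMinimalFort G' F := by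
  have hs : Function.Surjective (fun F : Set V' => e ⁻¹' F) := e.injective.preimage_surjective
  have hlt (F₁ F₂ : Set V') : e ⁻¹' F₁ ⊂ e ⁻¹' F₂ ↔ F₁ ⊂ F₂ := by
    simp only [ssubset_iff_subset_not_subset, e.surjective.preimage_subset_preimage_iff]
  simp only [IsMinimalFort, isFort_iso_iff, hs.forall, hlt]

theorem numMinimalForts_congr [Finite V] [Finite V'] (e : G ≃g G') :
    numMinimalForts G = numMinimalForts G' := by
  have hi : Function.Injective (fun F : Set V' => e ⁻¹' F) := e.surjective.preimage_injective
  rw [numMinimalForts, numMinimalForts, ← Set.ncard_image_of_injective _ hi]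
  congr 1
  ext F
  constructor
  · intro h
    obtain ⟨F', rfl⟩ := e.injective.preimage_surjective F
    exact ⟨F', (isMinimalFort_iso_iff e F').1 h, rfl⟩
  · rintro ⟨F', h, rfl⟩
    exact (isMinimalFort_iso_iff e F').2 h

/-- `join` respects isomorphisms of rooted graphs. -/
def joinCongr (e : G ≃g G') (f : H ≃g H') (he : e r = r') (hf : f s = s') :
    join G r H s ≃g join G' r' H' s' where
  toEquiv := Equiv.sumCongr e.toEquiv f.toEquiv
  map_rel_iff' := by
    subst he hf
    rintro (_ | _) (_ | _) <;> simp [e.map_adj_iff, f.map_adj_iff]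

/-- `join` is commutative if the root is disregarded. -/
def joinComm : join G r H s ≃g join H s G r where
  toEquiv := Equiv.sumComm V W
  map_rel_iff' := by
    rintro (_ | _) (_ | _) <;> simp [and_comm]

/-- Graphs may be joined to the left part of a join first. -/
def joinLeft {y : V} : join (join G r H s) (.inl y) K x ≃g join (join G y K x) (.inl r) H s where
  toFun := fun
    | .inl (.inl v) => .inl (.inl v)
    | .inl (.inr v) => .inr v
    | .inr v => .inl (.inr v)
  invFun := fun
    | .inl (.inl v) => .inl (.inl v)
    | .inl (.inr v) => .inr v
    | .inr v => .inl (.inr v)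
  left_inv := by rintro ((_ | _) | _) <;> rfl
  right_inv := by rintro ((_ | _) | _) <;> rfl
  map_rel_iff' := by
    rintro ((_ | _) | _) ((_ | _) | _) <;> simp

/-- Graphs may be joined to the right part of a join first. -/
def joinRight {y : W} : join (join G r H s) (.inr y) K x ≃g join G r (join H y K x) (.inl s) where
  toEquiv := Equiv.sumAssoc V W X
  map_rel_iff' := by
    rintro ((_ | _) | _) ((_ | _) | _) <;> simp

theorem card_edgeSet_join_le [Finite V] [Finite W] : Nat.card (join G r H s).edgeSet ≤
    Nat.card G.edgeSet + Nat.card H.edgeSet + 1 := by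
  have h : (join G r H s).edgeSet ⊆ (G ⊕g H).edgeSet ∪ {s(.inl r, .inr s)} := by
    rw [join, edgeSet_sup]
    exact Set.union_subset_union_right _ (by simp [edge])
  have h' := (Set.ncard_le_ncard h (Set.toFinite _)).trans (Set.ncard_union_le _ _)
  rwa [Set.ncard_singleton, ← Nat.card_coe_set_eq, ← Nat.card_coe_set_eq,
    Nat.card_congr edgeSetSumEquiv, Nat.card_sum] at h'

end Iso

namespace RTree

/-- Two rooted trees are isomorphic by a map that respects the roots. -/
def Equivalent (t t' : RTree) : Prop := ∃ e : t.graph ≃g t'.graph, e t.root = t'.root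

theorem Equivalent.refl (t : RTree) : t.Equivalent t := ⟨.refl, rfl⟩

theorem Equivalent.trans {t t' t'' : RTree} : t.Equivalent t' → t'.Equivalent t'' →
    t.Equivalent t'' := fun ⟨e, he⟩ ⟨f, hf⟩ => ⟨e.trans f, by simp [he, hf]⟩

theorem Equivalent.link {a a' b b' : RTree} : a.Equivalent a' → b.Equivalent b' →
    (link a b).Equivalent (link a' b') :=
  fun ⟨e, he⟩ ⟨f, hf⟩ => ⟨joinCongr e f he hf, congrArg Sum.inl he⟩

theorem equivalent_link_link (a b c : RTree) :
    (link (link a b) c).Equivalent (link (link a c) b) :=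
  ⟨joinLeft (G := a.graph) (H := b.graph) (K := c.graph) (y := a.root), rfl⟩

theorem link_comm (a b : RTree) : Nonempty ((link a b).graph ≃g (link b a).graph) :=
  ⟨joinComm (G := a.graph) (H := b.graph)⟩

/-- A rooted tree can be attached to any vertex of another one. -/
theorem exists_graft (t : RTree) (y : t.Vert) (c : RTree) :
    ∃ t' : RTree, ∃ e : join t.graph y c.graph c.root ≃g t'.graph, e (.inl t.root) = t'.root := by
  induction t with
  | single => exact ⟨link single c, .refl, rfl⟩
  | link a b iha ihb =>
    rcases y with y | y
    · obtain ⟨t', e, he⟩ := iha y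
      exact ⟨link t' b, (joinLeft (G := a.graph) (r := a.root) (H := b.graph) (s := b.root)
        (K := c.graph) (x := c.root) (y := y)).trans (joinCongr e .refl he rfl),
        congrArg Sum.inl he⟩
    · obtain ⟨t', e, he⟩ := ihb y
      exact ⟨link a t', (joinRight (G := a.graph) (r := a.root) (H := b.graph) (s := b.root)
        (K := c.graph) (x := c.root) (y := y)).trans (joinCongr .refl e rfl he), rfl⟩

theorem graph_connected (t : RTree) : t.graph.Connected := by
  induction t with
  | single => exact (IsTree.of_subsingleton (V := Unit)).connected
  | link a b iha ihb => exact join_connected iha ihb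

/-- Each `link` adds a single edge. Together with connectedness this bound makes the graph a tree,
with no need to discuss cycles. -/
theorem card_edgeSet_graph_le (t : RTree) : Nat.card t.graph.edgeSet + 1 ≤ Nat.card t.Vert := by
  induction t with
  | single =>
    have h : IsEmpty (single.graph).edgeSet := by
      change IsEmpty (⊥ : SimpleGraph Unit).edgeSet
      simp
    rw [Nat.card_of_isEmpty, card_vert, size]
  | link a b iha ihb =>
    rw [card_vert] at *
    have := card_edgeSet_join_le (G := a.graph) (r := a.root) (H := b.graph) (s := b.root)
    change Nat.card (join _ _ _ _).edgeSet + 1 ≤ size _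
    rw [size]
    omega

theorem graph_isTree (t : RTree) : t.graph.IsTree :=
  isTree_iff_connected_and_card.2 ⟨t.graph_connected,
    t.card_edgeSet_graph_le.antisymm t.graph_connected.card_vert_le_card_edgeSet_add_one⟩

end RTree

/-! ### Every tree is the graph of a rooted tree -/

open RTree

/-- Removing a leaf and attaching it again. -/
theorem nonempty_iso_join_of_leaf {V : Type*} {G : SimpleGraph V} {u p : V} (hp : G.Adj u p)
    (hu : ∀ y, G.Adj u y → y = p) :
    ∃ e : G ≃g join (G.induce {u}ᶜ) ⟨p, hp.ne'⟩ (⊥ : SimpleGraph Unit) (),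
      ∀ v (hv : v ≠ u), e v = .inl ⟨v, hv⟩ := by
  classical
  let f : ({u}ᶜ : Set V) ⊕ Unit → V := Sum.elim (↑) fun _ => u
  have hf : Function.Bijective f := by
    constructor
    · rintro (⟨x, hx⟩ | _) (⟨y, hy⟩ | _) h
      · simpa [f] using h
      · exact (hx h).elim
      · exact (hy h.symm).elim
      · rfl
    · intro v
      by_cases hv : v = u
      · exact ⟨.inr (), hv.symm⟩
      · exact ⟨.inl ⟨v, hv⟩, rfl⟩
  let e : join (G.induce {u}ᶜ) ⟨p, hp.ne'⟩ (⊥ : SimpleGraph Unit) () ≃g G :=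
    { toEquiv := Equiv.ofBijective f hf
      map_rel_iff' := by
        rintro (⟨x, hx⟩ | _) (⟨y, hy⟩ | _)
        · simp [f]
        · simp only [Equiv.ofBijective_apply, f, Sum.elim_inl, Sum.elim_inr, join_adj_inl_inr,
            and_true]
          exact ⟨fun h => Subtype.ext (hu _ h.symm), fun h => by obtain rfl : x = p := congrArg Subtype.val h; exact hp.symm⟩
        · simp only [Equiv.ofBijective_apply, f, Sum.elim_inl, Sum.elim_inr, join_adj_inr_inl,
            and_true]
          exact ⟨fun h => Subtype.ext (hu _ h), fun h => by obtain rfl : y = p := congrArg Subtype.val h; exact hp⟩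
        · simp [f] }
  refine ⟨e.symm, fun v hv => ?_⟩
  rw [RelIso.symm_apply_eq]
  rfl

/-- A nontrivial tree has two leaves, so one of them differs from the prescribed root `w`, which
therefore survives the removal. -/
theorem exists_leaf {V : Type*} [Finite V] [Nontrivial V] {G : SimpleGraph V} (hG : G.IsTree)
    (w : V) : ∃ u p, u ≠ w ∧ G.Adj u p ∧ (∀ y, G.Adj u y → y = p) ∧
      (G.induce {u}ᶜ).IsTree := by
  classical
  have := Fintype.ofFinite V
  have key (u : V) (hu : G.degree u = 1) (huw : u ≠ w) : ∃ u p, u ≠ w ∧ G.Adj u p ∧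
      (∀ y, G.Adj u y → y = p) ∧ (G.induce {u}ᶜ).IsTree := by
    obtain ⟨p, hp, hup⟩ := degree_eq_one_iff_existsUnique_adj.1 hu
    exact ⟨u, p, huw, hp, hup, hG.connected.induce_compl_singleton_of_degree_eq_one hu,
      hG.isAcyclic.induce _⟩
  obtain ⟨u, v, huv, hu, hv⟩ := hG.exists_ne_and_degree_eq_one
  by_cases h : u = w
  · exact key v hv (h ▸ huv.symm)
  · exact key u hu h

/-- Every tree with a given vertex is isomorphic to a rooted tree. -/
theorem exists_rooted {V : Type*} [Finite V] {G : SimpleGraph V} (hG : G.IsTree) (w : V) :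
    ∃ t : RTree, ∃ e : G ≃g t.graph, e w = t.root := by
  obtain ⟨n, hn⟩ : ∃ n, Nat.card V = n := ⟨_, rfl⟩
  induction n using Nat.strong_induction_on generalizing V with
  | _ n ih =>
    rcases subsingleton_or_nontrivial V with hV | hV
    · have : Unique V := ⟨⟨w⟩, fun _ => Subsingleton.elim _ _⟩
      exact ⟨single, ⟨Equiv.ofUnique V Unit, by
        intro x y
        rw [Subsingleton.elim x y]
        simp⟩, rfl⟩
    · obtain ⟨u, p, huw, hp, hup, ht⟩ := exists_leaf hG w
      have hcard : Nat.card ({u}ᶜ : Set V) < n := by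
        rw [← hn, Nat.card_coe_set_eq]
        exact Set.ncard_lt_card (by simp)
      obtain ⟨t, e, he⟩ := ih _ hcard ht ⟨w, huw.symm⟩ rfl
      obtain ⟨f, hf⟩ := nonempty_iso_join_of_leaf hp hup
      -- The leaf may have hung at any vertex, not only at the root, so it is grafted back there.
      obtain ⟨t', g, hg⟩ := exists_graft t (e ⟨p, hp.ne'⟩) single
      refine ⟨t', (f.trans (joinCongr e (.refl (G := single.graph)) rfl rfl)).trans g, ?_⟩
      rw [← hg, ← he]
      exact congrArg (fun z => g (joinCongr e (.refl (G := single.graph)) rfl rfl z))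
        (hf w huw.symm)

/-- Every nontrivial tree can be rooted at a leaf. -/
theorem exists_planted {V : Type*} [Finite V] [Nontrivial V] {G : SimpleGraph V}
    (hG : G.IsTree) : ∃ t : RTree, Nonempty (G ≃g (link single t).graph) := by
  obtain ⟨w⟩ := hG.connected.nonempty
  obtain ⟨u, p, -, hp, hup, ht⟩ := exists_leaf hG w
  obtain ⟨t, e, he⟩ := exists_rooted ht ⟨p, hp.ne'⟩
  obtain ⟨f, -⟩ := nonempty_iso_join_of_leaf hp hup
  exact ⟨t, ⟨(f.trans (joinCongr e (.refl (G := single.graph)) he rfl)).trans joinComm⟩⟩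

/-! ### Sorting the children of a rooted tree -/

namespace RTree

/-- Attach `c` to the root of a rooted tree in front of the children which are larger than `c`. -/
def insertChild : RTree → RTree → RTree
  | single, c => link single c
  | link a b, c => if b.size ≤ c.size then link (link a b) c else link (insertChild a c) b

/-- Sort the children of each vertex by the sizes of their subtrees. -/
def sorted : RTree → RTree
  | single => single
  | link a b => insertChild a.sorted b.sorted

theorem equivalent_insertChild (a c : RTree) : (link a c).Equivalent (insertChild a c) := by
  induction a with
  | single => exact .refl _
  | link a b iha ihb =>
    rw [insertChild]
    split_ifs
    · exact .refl _
    · exact (equivalent_link_link a b c).trans (iha.link (.refl b))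

theorem equivalent_sorted (t : RTree) : t.Equivalent t.sorted := by
  induction t with
  | single => exact .refl _
  | link a b iha ihb => exact (iha.link ihb).trans (equivalent_insertChild _ _)

theorem size_insertChild (a c : RTree) : (insertChild a c).size = a.size + c.size := by
  induction a with
  | single => rfl
  | link a b iha ihb =>
    rw [insertChild]
    split_ifs
    · rfl
    · rw [size, iha, size]; omega

@[simp] theorem size_sorted (t : RTree) : t.sorted.size = t.size := by
  induction t with
  | single => rfl
  | link a b iha ihb => rw [sorted, size_insertChild, iha, ihb, size]

theorem Profile.link_right_comm (x y z : Profile) :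
    (x.link y).link z = (x.link z).link y := by
  ext <;> simp only [Profile.link] <;> ring

theorem profile_insertChild (a c : RTree) :
    (insertChild a c).profile = a.profile.link c.profile := by
  induction a with
  | single => rfl
  | link a b iha ihb =>
    rw [insertChild]
    split_ifs
    · rfl
    · rw [profile, iha, profile, Profile.link_right_comm]

@[simp] theorem profile_sorted (t : RTree) : t.sorted.profile = t.profile := by
  induction t with
  | single => rfl
  | link a b iha ihb => rw [sorted, profile_insertChild, iha, ihb, profile]

/-! ### Domination of profiles -/

/-- Componentwise comparison of profiles. -/
def Profile.ble (x y : Profile) : Bool :=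
  x.free.ble y.free && x.matched.ble y.matched && x.pending.ble y.pending && x.closed.ble y.closed

theorem Profile.ble_iff {x y : Profile} : x.ble y = true ↔ x.free ≤ y.free ∧
    x.matched ≤ y.matched ∧ x.pending ≤ y.pending ∧ x.closed ≤ y.closed := by
  simp [Profile.ble, and_assoc]

theorem Profile.ble_refl (x : Profile) : x.ble x = true := by simp [Profile.ble_iff]

theorem Profile.ble_trans {x y z : Profile} (h : x.ble y = true) (h' : y.ble z = true) :
    x.ble z = true := by
  rw [Profile.ble_iff] at *
  omega

/-- The entries of `Profile.link` are polynomials with nonnegative coefficients. By this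
monotonicity a branch may be replaced by any profile that bounds its own. -/
theorem Profile.link_ble_link {x x' y y' : Profile} (hx : x.ble x' = true)
    (hy : y.ble y' = true) : (x.link y).ble (x'.link y') = true := by
  rw [Profile.ble_iff] at *
  obtain ⟨h1, h2, h3, h4⟩ := hx
  obtain ⟨k1, k2, k3, k4⟩ := hy
  simp only [Profile.link]
  refine ⟨?_, ?_, ?_, ?_⟩ <;> gcongr

/-- The number of minimal forts of the tree obtained by attaching a new vertex to the root. -/
def Profile.planted (x : Profile) : ℕ := x.free + x.pending + x.closed

/-- With the new leaf as root, a pending part is completed by the leaf, a free part takes it as its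
partner, and a closed part does without it. A matched part contributes nothing: the leaf would have
exactly one neighbor in it, and adding the leaf would give the root of `t` a second neighbor in the
set. -/
theorem numMinimalForts_planted (t : RTree) :
    numMinimalForts (link single t).graph = t.profile.planted := by
  rw [numMinimalForts_graph]
  simp only [profile, Profile.link, Profile.planted]
  ring

theorem Profile.planted_mono {x y : Profile} (h : x.ble y = true) : x.planted ≤ y.planted := by
  rw [Profile.ble_iff] at h
  simp only [Profile.planted]
  omega

/-- The star with `k` leaves, rooted at its center. -/
def starTree : ℕ → RTree
  | 0 => single
  | k + 1 => link (starTree k) single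

/-- Attach `k` copies of `c` to the root of `t`. -/
def attach (t c : RTree) : ℕ → RTree
  | 0 => t
  | k + 1 => link (attach t c k) c

/-- The rooted tree whose root has `a` children with `3` children each and `b` children with `4`
children each. -/
def spider (a b : ℕ) : RTree := attach (attach single (starTree 3) a) (starTree 4) b

/-- The rooted trees that are left of `T(19, 4, 4, 2)`, rooted at a leaf, when its root and
possibly further branches are removed. -/
def exceptional : List RTree :=
  [starTree 0, starTree 1, starTree 2, starTree 3, starTree 4,
   spider 1 0, spider 0 1, spider 2 0, spider 1 1, spider 0 2, spider 2 1, spider 1 2,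
   link (starTree 0) (spider 2 1), link (starTree 1) (spider 2 1), link (starTree 2) (spider 2 1),
   link (starTree 3) (spider 2 1),
   link (starTree 0) (spider 1 2), link (starTree 1) (spider 1 2), link (starTree 2) (spider 1 2)]

/-- The entry with index `n` is a list of profiles such that every rooted tree with `n` vertices is
exceptional up to sorting or has a profile that is bounded by one of these. -/
def dominatingTable : List (List Profile) := [
  [],
  [],
  [],
  [⟨1, 0, 1, 0⟩],
  [⟨2, 0, 0, 1⟩, ⟨1, 1, 2, 1⟩],
  [⟨2, 1, 2, 1⟩, ⟨0, 2, 3, 3⟩],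
  [⟨3, 0, 2, 3⟩, ⟨2, 2, 3, 1⟩, ⟨1, 3, 3, 3⟩, ⟨0, 0, 5, 10⟩],
  [⟨5, 0, 0, 10⟩, ⟨3, 2, 4, 3⟩, ⟨2, 3, 3, 3⟩, ⟨0, 4, 4, 6⟩, ⟨0, 0, 6, 15⟩],
  [⟨6, 0, 0, 15⟩, ⟨4, 3, 5, 3⟩, ⟨4, 0, 4, 6⟩, ⟨3, 3, 4, 6⟩, ⟨0, 5, 5, 10⟩, ⟨0, 0, 7, 21⟩],
  [⟨8, 0, 0, 21⟩, ⟨6, 3, 2, 4⟩, ⟨5, 4, 7, 3⟩, ⟨5, 0, 5, 10⟩, ⟨4, 4, 6, 8⟩, ⟨2, 6, 6, 15⟩, ⟨0, 0,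
   8, 28⟩],
  [⟨10, 0, 2, 28⟩, ⟨8, 4, 2, 7⟩, ⟨7, 5, 9, 3⟩, ⟨6, 6, 3, 4⟩, ⟨6, 4, 8, 15⟩, ⟨5, 6, 6, 12⟩, ⟨3,
   9, 9, 6⟩, ⟨2, 8, 8, 21⟩, ⟨0, 0, 9, 36⟩],
  [⟨15, 0, 0, 16⟩, ⟨12, 0, 4, 36⟩, ⟨10, 5, 2, 11⟩, ⟨9, 7, 12, 6⟩, ⟨8, 8, 3, 7⟩, ⟨8, 6, 11, 21⟩,
   ⟨6, 9, 7, 16⟩, ⟨4, 12, 12, 9⟩, ⟨2, 10, 10, 30⟩, ⟨0, 0, 10, 45⟩],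
  [⟨20, 0, 2, 22⟩, ⟨12, 9, 16, 6⟩, ⟨12, 9, 4, 16⟩, ⟨12, 4, 16, 9⟩, ⟨11, 8, 14, 21⟩, ⟨10, 12, 3,
   11⟩, ⟨10, 2, 12, 30⟩, ⟨10, 0, 0, 45⟩, ⟨8, 10, 9, 23⟩, ⟨7, 10, 16, 16⟩, ⟨5, 15, 3, 13⟩, ⟨4,
   12, 12, 40⟩, ⟨0, 16, 16, 18⟩, ⟨0, 0, 11, 55⟩],
  [⟨27, 0, 0, 9⟩, ⟨25, 0, 0, 24⟩, ⟨20, 0, 2, 29⟩, ⟨18, 9, 2, 7⟩, ⟨16, 12, 21, 6⟩, ⟨16, 12, 16,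
   9⟩, ⟨16, 8, 17, 22⟩, ⟨15, 12, 6, 16⟩, ⟨14, 11, 19, 23⟩, ⟨12, 10, 16, 40⟩, ⟨11, 0, 0, 55⟩,
   ⟨10, 15, 13, 22⟩, ⟨6, 18, 9, 28⟩, ⟨4, 12, 21, 16⟩, ⟨3, 10, 22, 11⟩, ⟨2, 20, 20, 24⟩, ⟨2, 10,
   13, 52⟩, ⟨0, 12, 17, 35⟩, ⟨0, 0, 12, 66⟩],
  [⟨32, 0, 0, 27⟩, ⟨30, 0, 2, 31⟩, ⟨24, 12, 2, 10⟩, ⟨24, 0, 12, 37⟩, ⟨22, 4, 22, 24⟩, ⟨21, 16,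
   28, 6⟩, ⟨20, 16, 28, 9⟩, ⟨20, 15, 5, 13⟩, ⟨20, 10, 4, 33⟩, ⟨19, 14, 25, 23⟩, ⟨18, 18, 3, 7⟩,
   ⟨17, 16, 24, 22⟩, ⟨16, 12, 22, 40⟩, ⟨15, 18, 6, 15⟩, ⟨14, 18, 11, 26⟩, ⟨13, 2, 18, 52⟩, ⟨12,
   16, 14, 32⟩, ⟨12, 0, 0, 66⟩, ⟨9, 27, 12, 10⟩, ⟨9, 6, 24, 28⟩, ⟨8, 24, 11, 25⟩, ⟨8, 20, 12,
   42⟩, ⟨6, 27, 27, 16⟩, ⟨4, 12, 17, 56⟩, ⟨2, 20, 23, 33⟩, ⟨0, 25, 25, 24⟩, ⟨0, 16, 21, 44⟩, ⟨0,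
   2, 14, 65⟩, ⟨0, 0, 13, 78⟩],
  [⟨45, 0, 0, 19⟩, ⟨40, 0, 2, 34⟩, ⟨36, 0, 4, 39⟩, ⟨32, 16, 2, 13⟩, ⟨30, 15, 2, 17⟩, ⟨28, 21,
   37, 6⟩, ⟨28, 20, 36, 9⟩, ⟨27, 21, 12, 13⟩, ⟨27, 6, 33, 16⟩, ⟨25, 19, 33, 23⟩, ⟨25, 12, 25,
   46⟩, ⟨24, 24, 3, 10⟩, ⟨24, 18, 15, 28⟩, ⟨22, 22, 32, 26⟩, ⟨22, 16, 28, 43⟩, ⟨20, 24, 6, 18⟩,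
   ⟨20, 20, 5, 35⟩, ⟨18, 27, 7, 19⟩, ⟨18, 24, 14, 31⟩, ⟨18, 13, 24, 56⟩, ⟨16, 22, 18, 44⟩, ⟨14,
   0, 2, 78⟩, ⟨12, 36, 12, 12⟩, ⟨12, 24, 36, 10⟩, ⟨12, 24, 29, 37⟩, ⟨11, 24, 26, 51⟩, ⟨10, 32,
   32, 27⟩, ⟨8, 30, 14, 37⟩, ⟨5, 20, 35, 13⟩, ⟨4, 30, 30, 33⟩, ⟨4, 16, 19, 70⟩, ⟨0, 16, 23, 62⟩,
   ⟨0, 9, 25, 52⟩, ⟨0, 4, 18, 79⟩, ⟨0, 0, 22, 65⟩, ⟨0, 0, 14, 91⟩],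
  [⟨64, 0, 2, 25⟩, ⟨50, 0, 9, 52⟩, ⟨40, 20, 6, 39⟩, ⟨37, 28, 49, 9⟩, ⟨36, 28, 14, 27⟩, ⟨36, 27,
   36, 16⟩, ⟨33, 25, 44, 26⟩, ⟨32, 36, 7, 22⟩, ⟨32, 24, 42, 31⟩, ⟨30, 12, 36, 37⟩, ⟨28, 22, 38,
   44⟩, ⟨26, 11, 35, 51⟩, ⟨25, 28, 37, 46⟩, ⟨24, 32, 18, 43⟩, ⟨24, 27, 16, 50⟩, ⟨24, 18, 31,
   56⟩, ⟨23, 4, 20, 70⟩, ⟨18, 0, 4, 91⟩, ⟨16, 48, 20, 25⟩, ⟨16, 30, 23, 65⟩, ⟨12, 40, 18, 51⟩,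
   ⟨12, 32, 48, 13⟩, ⟨12, 18, 25, 80⟩, ⟨7, 45, 45, 19⟩, ⟨6, 36, 38, 43⟩, ⟨5, 40, 40, 35⟩, ⟨4,
   25, 29, 71⟩, ⟨0, 27, 34, 56⟩, ⟨0, 22, 33, 59⟩, ⟨0, 12, 30, 66⟩, ⟨0, 11, 27, 77⟩, ⟨0, 5, 36,
   48⟩, ⟨0, 4, 31, 63⟩, ⟨0, 4, 23, 89⟩, ⟨0, 0, 24, 85⟩, ⟨0, 0, 19, 97⟩, ⟨0, 0, 15, 105⟩],
  [⟨81, 0, 2, 28⟩, ⟨60, 0, 12, 46⟩, ⟨54, 27, 2, 25⟩, ⟨49, 37, 65, 9⟩, ⟨48, 48, 17, 29⟩, ⟨48, 12,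
   52, 19⟩, ⟨44, 33, 58, 26⟩, ⟨42, 32, 56, 31⟩, ⟨40, 32, 19, 57⟩, ⟨40, 30, 45, 37⟩, ⟨38, 28, 50,
   44⟩, ⟨37, 25, 53, 46⟩, ⟨36, 36, 63, 16⟩, ⟨35, 26, 42, 56⟩, ⟨34, 4, 29, 71⟩, ⟨32, 42, 23, 62⟩,
   ⟨31, 0, 12, 77⟩, ⟨25, 13, 30, 80⟩, ⟨24, 38, 18, 77⟩, ⟨24, 0, 4, 105⟩, ⟨23, 16, 46, 65⟩, ⟨22,
   37, 33, 66⟩, ⟨22, 33, 29, 74⟩, ⟨20, 60, 27, 31⟩, ⟨20, 36, 64, 27⟩, ⟨18, 24, 56, 43⟩, ⟨18, 24,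
   52, 51⟩, ⟨16, 50, 22, 67⟩, ⟨16, 28, 27, 85⟩, ⟨9, 50, 50, 52⟩, ⟨7, 32, 68, 22⟩, ⟨6, 40, 60,
   39⟩, ⟨4, 24, 26, 105⟩, ⟨2, 64, 64, 25⟩, ⟨0, 64, 5, 31⟩, ⟨0, 37, 50, 58⟩, ⟨0, 33, 45, 70⟩, ⟨0,
   32, 43, 73⟩, ⟨0, 28, 39, 82⟩, ⟨0, 26, 36, 87⟩, ⟨0, 25, 38, 84⟩, ⟨0, 12, 49, 61⟩, ⟨0, 5, 41,
   75⟩, ⟨0, 4, 30, 100⟩, ⟨0, 0, 35, 90⟩, ⟨0, 0, 34, 92⟩, ⟨0, 0, 32, 96⟩, ⟨0, 0, 28, 104⟩, ⟨0, 0,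
   25, 109⟩, ⟨0, 0, 24, 112⟩, ⟨0, 0, 20, 116⟩, ⟨0, 0, 16, 120⟩]]

/-- The profiles that dominate those of the unexceptional rooted trees with `n` vertices. -/
def dominating (n : ℕ) : List Profile := dominatingTable.getD n []

/-- `x` is dominated at size `n`, or yields at most `161` minimal forts if `n = 18`. -/
def Fits (n : ℕ) (x : Profile) : Prop :=
  if n = 18 then x.planted ≤ 161 else ∃ d ∈ dominating n, x.ble d = true

instance (n : ℕ) (x : Profile) : Decidable (Fits n x) := by unfold Fits; infer_instance

theorem Fits.of_ble {n : ℕ} {x y : Profile} (h : Fits n y) (hxy : x.ble y = true) : Fits n x := by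
  unfold Fits at *
  split_ifs at h ⊢
  · exact (Profile.planted_mono hxy).trans h
  · obtain ⟨d, hd, h⟩ := h
    exact ⟨d, hd, Profile.ble_trans hxy h⟩

/-- This and the next two statements are the finite certificate of the dynamic program. Exceptional
pieces either assemble to a larger exceptional piece or fall under the bounds; as soon as one branch
is unexceptional, only bounds remain. -/
theorem exceptional_link_exceptional : ∀ x ∈ exceptional, ∀ y ∈ exceptional,
    x.size + y.size ≤ 18 → insertChild x y ∈ exceptional ∨
      Fits (x.size + y.size) (x.profile.link y.profile) := by
  decide +kernel

theorem exceptional_link_dominating : ∀ x ∈ exceptional, ∀ k < 18, x.size + k ≤ 18 →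
    ∀ d ∈ dominating k, Fits (x.size + k) (x.profile.link d) ∧
      Fits (k + x.size) (d.link x.profile) := by
  decide +kernel

theorem dominating_link_dominating : ∀ k < 18, ∀ l < 18, k + l ≤ 18 →
    ∀ d ∈ dominating k, ∀ e ∈ dominating l, Fits (k + l) (d.link e) := by
  decide +kernel

/-- Induction over `link`. The shape of the tree matters only if both branches are exceptional;
otherwise monotonicity reduces the claim to the certified pairs of bounding profiles. -/
theorem sorted_mem_exceptional_or_fits (t : RTree) (ht : t.size ≤ 18) :
    t.sorted ∈ exceptional ∨ Fits t.size t.profile := by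
  induction t with
  | single => exact .inl (by decide)
  | link a b iha ihb =>
    have pos (t : RTree) : 0 < t.size := by induction t <;> simp only [size] <;> omega
    have hab : a.size + b.size ≤ 18 := ht
    have hb := pos b
    have ha := pos a
    -- Both branches are nonempty and hence have fewer than 18 vertices, where `Fits` means
    -- domination. Its special meaning at 18 is only ever a conclusion.
    have fit (t : RTree) (h : t.size < 18) (hf : Fits t.size t.profile) :
        ∃ d ∈ dominating t.size, t.profile.ble d = true := by
      rwa [Fits, if_neg h.ne] at hf
    change insertChild a.sorted b.sorted ∈ _ ∨ Fits (a.size + b.size) (a.profile.link b.profile)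
    rcases iha (by omega) with h1 | h1 <;> rcases ihb (by omega) with h2 | h2
    · simpa using exceptional_link_exceptional _ h1 _ h2 (by simpa using hab)
    · obtain ⟨d, hd, hle⟩ := fit b (by omega) h2
      have := (exceptional_link_dominating _ h1 b.size (by omega) (by simpa using hab) d hd).1
      simp only [size_sorted, profile_sorted] at this
      exact .inr (this.of_ble (Profile.link_ble_link (Profile.ble_refl _) hle))
    · obtain ⟨d, hd, hle⟩ := fit a (by omega) h1
      have := (exceptional_link_dominating _ h2 a.size (by omega)
        (by simpa [add_comm] using hab) d hd).2
      simp only [size_sorted, profile_sorted] at this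
      exact .inr (this.of_ble (Profile.link_ble_link hle (Profile.ble_refl _)))
    · obtain ⟨d, hd, hle⟩ := fit a (by omega) h1
      obtain ⟨e, he, hle'⟩ := fit b (by omega) h2
      exact .inr ((dominating_link_dominating a.size (by omega) b.size (by omega) hab d hd e
        he).of_ble (Profile.link_ble_link hle hle'))

end RTree

/-! ### The bound for trees rooted at a leaf, and the equality case -/

open RTree

/-- The maximum number of minimal forts of trees with `n` vertices, where `1 ≤ n ≤ 19`. -/
def treeMax (n : ℕ) : ℕ := if n ≤ 3 then 1 else if n ≤ 18 then (n - 1).choose 2 else 162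

theorem exceptional_planted_le : ∀ x ∈ exceptional, x.profile.planted ≤ treeMax (x.size + 1) := by
  decide +kernel

theorem dominating_planted_le :
    ∀ k < 18, ∀ d ∈ dominating k, d.planted ≤ treeMax (k + 1) := by
  decide +kernel

theorem planted_le_treeMax (t : RTree) (ht : t.size ≤ 18) :
    t.profile.planted ≤ treeMax (t.size + 1) := by
  rcases sorted_mem_exceptional_or_fits t ht with h | h
  · simpa using exceptional_planted_le _ h
  · by_cases h18 : t.size = 18
    · rw [h18] at h ⊢
      exact h.trans (by decide)
    · rw [Fits, if_neg h18] at h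
      obtain ⟨d, hd, hle⟩ := h
      exact (Profile.planted_mono hle).trans (dominating_planted_le _ (by omega) d hd)

/-- The two cases come from the two kinds of leaves of `T(19,4,4,2)`: the removed leaf hung on a
branch with four leaves or on one with three. -/
theorem exceptional_eq_of_size : ∀ x ∈ exceptional, x.size = 18 →
    x = link (starTree 3) (spider 2 1) ∨ x = link (starTree 2) (spider 1 2) := by
  decide +kernel

theorem planted_iso_spider (t : RTree) (ht : t.size = 18) (h : t.profile.planted = 162) :
    Nonempty ((link single t).graph ≃g (spider 2 2).graph) := by
  have iso {a b : RTree} : a.Equivalent b → Nonempty (a.graph ≃g b.graph) := fun ⟨e, _⟩ => ⟨e⟩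
  have hmem : t.sorted ∈ exceptional := by
    refine (sorted_mem_exceptional_or_fits t ht.le).resolve_right fun hf => ?_
    rw [Fits, if_pos ht] at hf
    omega
  obtain ⟨e₁⟩ := iso ((Equivalent.refl single).link (equivalent_sorted t))
  obtain ⟨e₂⟩ := link_comm single t.sorted
  obtain ⟨e₃⟩ := iso (equivalent_sorted (link t.sorted single))
  suffices Nonempty ((link t.sorted single).sorted.graph ≃g (spider 2 2).graph) from
    this.map ((e₁.trans e₂).trans e₃).trans
  -- Sorting puts the restored leaf in front of the large branch, next to its sibling leaves.
  -- Exchanging the two sides then moves the root to the center.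
  rcases exceptional_eq_of_size _ hmem (by simpa using ht) with hx | hx
  · rw [hx]
    exact link_comm (starTree 4) (spider 2 1)
  · rw [hx]
    obtain ⟨e₄⟩ := link_comm (starTree 3) (spider 1 2)
    -- The branch with three leaves now stands last and has to move in front of those with four.
    obtain ⟨e₅⟩ := iso (equivalent_sorted (link (spider 1 2) (starTree 3)))
    exact ⟨e₄.trans e₅⟩

/-! ### Upper bounds -/

theorem numMinimalForts_le_treeMax {V : Type*} [Finite V] {G : SimpleGraph V} (hG : G.IsTree)
    (hV : Nat.card V ≤ 19) : numMinimalForts G ≤ treeMax (Nat.card V) := by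
  rcases subsingleton_or_nontrivial V with h | h
  · obtain ⟨w⟩ := hG.connected.nonempty
    have hc : Nat.card V = 1 := Nat.card_eq_one_iff_unique.2 ⟨h, ⟨w⟩⟩
    rw [numMinimalForts, hc]
    refine (Set.ncard_le_ncard (t := {Set.univ}) ?_ (Set.toFinite _)).trans
      (Set.ncard_singleton _).le
    rintro F ⟨⟨⟨x, hx⟩, -⟩, -⟩
    exact Set.eq_univ_of_forall fun y => Subsingleton.elim x y ▸ hx
  · obtain ⟨t, ⟨e⟩⟩ := exists_planted hG
    have hc : Nat.card V = t.size + 1 := by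
      rw [Nat.card_congr e.toEquiv, card_vert, size, size, add_comm]
    rw [numMinimalForts_congr e, numMinimalForts_planted, hc]
    exact planted_le_treeMax t (by omega)

theorem iso_spider_of_numMinimalForts {V : Type*} [Finite V] {G : SimpleGraph V} (hG : G.IsTree)
    (hV : Nat.card V = 19) (h : numMinimalForts G = 162) :
    Nonempty (G ≃g (spider 2 2).graph) := by
  have : Nontrivial V := (Finite.one_lt_card_iff_nontrivial).1 (by omega)
  obtain ⟨t, ⟨e⟩⟩ := exists_planted hG
  have hc : Nat.card V = t.size + 1 := by
    rw [Nat.card_congr e.toEquiv, card_vert, size, size, add_comm]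
  rw [numMinimalForts_congr e, numMinimalForts_planted] at h
  exact (planted_iso_spider t (by omega) h).map e.trans

/-! ### Disjoint unions and forests -/

section Sum

variable {V W : Type*} {G : SimpleGraph V} {H : SimpleGraph W}

theorem isFort_sum_iff (F : Set (V ⊕ W)) : IsFort (G ⊕g H) F ↔ F.Nonempty ∧
    (∀ v ∉ (Sum.inl ⁻¹' F : Set V), HasNone G (Sum.inl ⁻¹' F) v ∨ HasTwo G (Sum.inl ⁻¹' F) v) ∧
    (∀ w ∉ (Sum.inr ⁻¹' F : Set W),
      HasNone H (Sum.inr ⁻¹' F) w ∨ HasTwo H (Sum.inr ⁻¹' F) w) := by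
  simp only [isFort_iff, HasNone, HasTwo, Sum.forall, Sum.exists, sum_adj_inl, sum_adj_inr,
    Set.mem_preimage, not_adj_sum_inl_inr, (G ⊕g H).adj_comm (.inr _) (.inl _), false_and,
    and_false, exists_false, or_false, false_or, IsEmpty.forall_iff, implies_true, and_true,
    true_and, ne_eq, Sum.inl.injEq, Sum.inr.injEq]

theorem isFort_sum_inl_iff (F : Set V) : IsFort (G ⊕g H) (Sum.inl '' F) ↔ IsFort G F := by
  have h : (Sum.inr ⁻¹' (Sum.inl '' F) : Set W) = ∅ := by ext; simp
  rw [isFort_sum_iff, Set.preimage_image_eq _ Sum.inl_injective, h, isFort_iff, Set.image_nonempty]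
  simp [hasNone_empty]

theorem isFort_sum_inr_iff (F : Set W) : IsFort (G ⊕g H) (Sum.inr '' F) ↔ IsFort H F := by
  have h : (Sum.inl ⁻¹' (Sum.inr '' F) : Set V) = ∅ := by ext; simp
  rw [isFort_sum_iff, Set.preimage_image_eq _ Sum.inr_injective, h, isFort_iff, Set.image_nonempty]
  simp [hasNone_empty]

/-- A minimal fort of a disjoint union lies in one of its two parts. -/
theorem IsMinimalFort.sum_cases {F : Set (V ⊕ W)} (h : IsMinimalFort (G ⊕g H) F) :
    (∃ F₁, IsMinimalFort G F₁ ∧ Sum.inl '' F₁ = F) ∨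
      (∃ F₂, IsMinimalFort H F₂ ∧ Sum.inr '' F₂ = F) := by
  obtain ⟨hF, hmin⟩ := h
  have eq_of (F' : Set (V ⊕ W)) (hs : F' ⊆ F) (hF' : IsFort (G ⊕g H) F') : F' = F :=
    hs.eq_or_ssubset.resolve_right fun h => hmin F' h hF'
  obtain ⟨⟨x, hx⟩, h1, h2⟩ := (isFort_sum_iff F).1 hF
  rcases x with x | x
  · have hf : IsFort G (Sum.inl ⁻¹' F) := (isFort_iff _ _).2 ⟨⟨x, hx⟩, h1⟩
    have he := eq_of _ (Set.image_preimage_subset _ _) (isFort_sum_inl_iff _ |>.2 hf)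
    refine .inl ⟨_, ⟨hf, fun F' hs hF' => ?_⟩, he⟩
    have := eq_of _ (Set.image_subset_iff.2 hs.1) ((isFort_sum_inl_iff _).2 hF')
    exact hs.2 (by rw [← this, Set.preimage_image_eq _ Sum.inl_injective])
  · have hf : IsFort H (Sum.inr ⁻¹' F) := (isFort_iff _ _).2 ⟨⟨x, hx⟩, h2⟩
    have he := eq_of _ (Set.image_preimage_subset _ _) (isFort_sum_inr_iff _ |>.2 hf)
    refine .inr ⟨_, ⟨hf, fun F' hs hF' => ?_⟩, he⟩
    have := eq_of _ (Set.image_subset_iff.2 hs.1) ((isFort_sum_inr_iff _).2 hF')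
    exact hs.2 (by rw [← this, Set.preimage_image_eq _ Sum.inr_injective])

theorem numMinimalForts_sum_le [Finite V] [Finite W] :
    numMinimalForts (G ⊕g H) ≤ numMinimalForts G + numMinimalForts H := by
  refine (Set.ncard_le_ncard (t := (Sum.inl '' ·) '' {F | IsMinimalFort G F} ∪
    (Sum.inr '' ·) '' {F | IsMinimalFort H F}) ?_ (Set.toFinite _)).trans
    ((Set.ncard_union_le _ _).trans
      (add_le_add (Set.ncard_image_le (Set.toFinite _)) (Set.ncard_image_le (Set.toFinite _))))
  exact fun F hF => hF.sum_cases

end Sum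

/-- A graph is the disjoint union of its parts on a set of vertices without outgoing edges and on
the complement of that set. -/
theorem nonempty_iso_sum {V : Type*} {G : SimpleGraph V} {S : Set V}
    (hS : ∀ v ∈ S, ∀ w ∉ S, ¬ G.Adj v w) :
    Nonempty (G.induce S ⊕g G.induce Sᶜ ≃g G) := by
  classical
  refine ⟨⟨Equiv.Set.sumCompl S, ?_⟩⟩
  rintro (⟨v, hv⟩ | ⟨v, hv⟩) (⟨w, hw⟩ | ⟨w, hw⟩)
  · simp
  · simpa using hS v hv w hw
  · simpa using fun h => hS w hw v hv h.symm
  · simp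

/-- The maximum number of minimal forts of forests with `n` vertices, where `n ≤ 19`. -/
def forestMax (n : ℕ) : ℕ := if n ≤ 4 then n else if n ≤ 18 then (n - 1).choose 2 else 162

theorem numMinimalForts_le_forestMax {V : Type*} [Finite V] {G : SimpleGraph V}
    (hG : G.IsAcyclic) (hV : Nat.card V ≤ 19) : numMinimalForts G ≤ forestMax (Nat.card V) := by
  obtain ⟨n, hn⟩ : ∃ n, Nat.card V = n := ⟨_, rfl⟩
  induction n using Nat.strong_induction_on generalizing V with
  | _ n ih =>
    rcases isEmpty_or_nonempty V with hV' | hV'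
    · rw [numMinimalForts, Set.eq_empty_of_forall_notMem (s := {F | IsMinimalFort G F}),
        Set.ncard_empty]
      · exact Nat.zero_le _
      · rintro F ⟨⟨⟨x, -⟩, -⟩, -⟩
        exact hV'.elim x
    obtain ⟨x⟩ := id hV'
    by_cases hc : G.Connected
    · have le : ∀ n < 20, n ≠ 0 → treeMax n ≤ forestMax n := by decide
      exact (numMinimalForts_le_treeMax ⟨hc, hG⟩ hV).trans
        (le _ (by omega) Nat.card_pos.ne')
    -- The component of `x` and its complement are both nonempty and have no edges between them.
    · let S : Set V := {v | G.Reachable x v}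
      have hS : ∀ v ∈ S, ∀ w ∉ S, ¬ G.Adj v w :=
        fun v hv w hw h => hw (Reachable.trans hv h.reachable)
      obtain ⟨e⟩ := nonempty_iso_sum hS
      have hx : x ∈ S := Reachable.refl x
      have hne : S.ncard ≠ 0 := (Set.ncard_pos (Set.toFinite S)).2 ⟨x, hx⟩ |>.ne'
      have hne' : Sᶜ.ncard ≠ 0 := by
        refine ((Set.ncard_pos (Set.toFinite Sᶜ)).2 (Set.nonempty_iff_ne_empty.2 fun h => ?_)).ne'
        refine hc ((connected_iff G).2 ⟨fun v w => ?_, hV'⟩)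
        have hall (v : V) : v ∈ S := Set.compl_empty_iff.1 h ▸ Set.mem_univ v
        exact Reachable.trans (Reachable.symm (hall v)) (hall w)
      have hsum := Set.ncard_add_ncard_compl S
      have hcard (T : Set V) : Nat.card T = T.ncard := Nat.card_coe_set_eq T
      have h1 := ih S.ncard (by omega) (hG.induce S) (by rw [hcard]; omega) (hcard S)
      have h2 := ih Sᶜ.ncard (by omega) (hG.induce Sᶜ) (by rw [hcard]; omega) (hcard Sᶜ)
      -- Superadditivity of the bound: in this range, splitting a forest never beats the claimed
      -- maximum.
      have add : ∀ k < 20, ∀ l < 20, k ≠ 0 → l ≠ 0 → k + l < 20 →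
          forestMax k + forestMax l ≤ forestMax (k + l) := by decide +kernel
      rw [hcard] at h1 h2
      rw [← numMinimalForts_congr e, ← hsum]
      exact numMinimalForts_sum_le.trans ((add_le_add h1 h2).trans
        (add _ (by omega) _ (by omega) hne hne' (by omega)))

/-! ### Extremal graphs -/

theorem exists_fin_iso (t : RTree) {n : ℕ} (hn : t.size = n) :
    ∃ G : SimpleGraph (Fin n), Nonempty (G ≃g t.graph) :=
  ⟨_, ⟨Iso.comap (Finite.equivFinOfCardEq (t.card_vert.trans hn)).symm t.graph⟩⟩

theorem mem_treeFortCounts (t : RTree) :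
    t.profile.free + t.profile.matched + t.profile.closed ∈ treeFortCounts t.size := by
  obtain ⟨G, ⟨e⟩⟩ := exists_fin_iso t rfl
  exact ⟨G, e.isTree_iff.2 t.graph_isTree, by rw [numMinimalForts_congr e, numMinimalForts_graph]⟩

theorem treeFortCounts_subset_forestFortCounts (n : ℕ) :
    treeFortCounts n ⊆ forestFortCounts n := by
  rintro k ⟨G, hG, hk⟩
  exact ⟨G, hG.isAcyclic, hk⟩

/-- Stars attain the value for `n ≤ 18`: with at least two leaves, their minimal forts are the pairs
of leaves. For `n = 19` the tree `spider 2 2` takes over. -/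
theorem treeMax_mem_treeFortCounts {n : ℕ} (h1 : 1 ≤ n) (h2 : n ≤ 19) :
    treeMax n ∈ treeFortCounts n := by
  have key : ∀ k < 18, (starTree k).size = k + 1 ∧ (starTree k).profile.free +
      (starTree k).profile.matched + (starTree k).profile.closed = treeMax (k + 1) := by decide +kernel
  rcases h2.eq_or_lt with rfl | h2
  · exact mem_treeFortCounts (spider 2 2)
  · obtain ⟨k, rfl⟩ := Nat.exists_eq_add_of_le' h1
    obtain ⟨hs, hk⟩ := key k (by omega)
    rw [← hk, ← hs]
    exact mem_treeFortCounts _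

theorem isGreatest_treeFortCounts {n : ℕ} (h1 : 1 ≤ n) (h2 : n ≤ 19) :
    IsGreatest (treeFortCounts n) (treeMax n) := by
  refine ⟨treeMax_mem_treeFortCounts h1 h2, ?_⟩
  rintro k ⟨G, hG, rfl⟩
  simpa using numMinimalForts_le_treeMax hG (by simpa using h2)

theorem numMinimalForts_bot (n : ℕ) : numMinimalForts (⊥ : SimpleGraph (Fin n)) = n := by
  have hfort (F : Set (Fin n)) : IsFort (⊥ : SimpleGraph (Fin n)) F ↔ F.Nonempty := by
    rw [isFort_iff, and_iff_left]
    exact fun v _ => .inl fun _ h => h.elim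
  -- Without edges every nonempty set is a fort, so the minimal ones are the singletons. This is
  -- what makes forests differ from trees for `2 ≤ n ≤ 4`.
  have h : {F : Set (Fin n) | IsMinimalFort ⊥ F} = Set.range fun x => {x} := by
    ext F
    simp only [IsMinimalFort, hfort, Set.mem_ofPred_eq, Set.mem_range]
    constructor
    · rintro ⟨⟨x, hx⟩, h⟩
      refine ⟨x, (Set.singleton_subset_iff.2 hx).eq_or_ssubset.resolve_right fun hs => ?_⟩
      exact h _ hs (Set.singleton_nonempty x)
    · rintro ⟨x, rfl⟩
      refine ⟨Set.singleton_nonempty x, fun F' hs => ?_⟩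
      rw [Set.ssubset_singleton_iff.1 hs]
      exact Set.not_nonempty_empty
  rw [numMinimalForts, h, ← Set.image_univ, Set.ncard_image_of_injective _ Set.singleton_injective,
    Set.ncard_univ, Nat.card_fin]

theorem isGreatest_forestFortCounts {n : ℕ} (h1 : 1 ≤ n) (h2 : n ≤ 19) :
    IsGreatest (forestFortCounts n) (forestMax n) := by
  constructor
  · by_cases h4 : n ≤ 4
    · refine ⟨⊥, isAcyclic_bot, ?_⟩
      rw [numMinimalForts_bot, forestMax, if_pos h4]
    · have h : forestMax n = treeMax n := by
        rw [forestMax, treeMax, if_neg h4, if_neg (show ¬ n ≤ 3 by omega)]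
      rw [h]
      exact treeFortCounts_subset_forestFortCounts n (treeMax_mem_treeFortCounts h1 h2)
  · rintro k ⟨G, hG, rfl⟩
    simpa using numMinimalForts_le_forestMax hG (by simpa using h2)

/-! ### The tree `T(19, 4, 4, 2)` -/

instance RTree.decidableEqVert : (t : RTree) → DecidableEq t.Vert
  | .single => inferInstanceAs (DecidableEq Unit)
  | .link a b =>
    have := decidableEqVert a
    have := decidableEqVert b
    inferInstanceAs (DecidableEq (a.Vert ⊕ b.Vert))

instance RTree.decidableAdj : (t : RTree) → DecidableRel t.graph.Adj
  | .single => fun _ _ => .isFalse fun h => h.elim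
  | .link a b =>
    have := decidableAdj a
    have := decidableAdj b
    fun
    | .inl _, .inl _ => decidable_of_iff _ (join_adj_inl_inl _ _).symm
    | .inl _, .inr _ => decidable_of_iff _ (join_adj_inl_inr _ _).symm
    | .inr _, .inl _ => decidable_of_iff _ (join_adj_inr_inl _ _).symm
    | .inr _, .inr _ => decidable_of_iff _ (join_adj_inr_inr _ _).symm

/-- Adjacency in `heightTwoTree`. -/
def heightTwoAdj {k m p : ℕ} : HeightTwoVertex k m p → HeightTwoVertex k m p → Bool
  | .root, .child _ => true
  | .child _, .root => true
  | .child i, .leaf i' _ => i = i'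
  | .leaf i' _, .child i => i = i'
  | _, _ => false

theorem heightTwoAdj_iff {k m p : ℕ} (x y : HeightTwoVertex k m p) :
    (heightTwoTree k m p).Adj x y ↔ heightTwoAdj x y = true := by
  cases x <;> cases y <;> simp [heightTwoTree, heightTwoAdj]

/-- An enumeration of the vertices of `T(19, 4, 4, 2)`. -/
def heightTwoVertex : Fin 19 → HeightTwoVertex 4 4 2 :=
  ![.root, .child 0, .child 1, .child 2, .child 3,
    .leaf 0 ⟨0, by decide⟩, .leaf 0 ⟨1, by decide⟩, .leaf 0 ⟨2, by decide⟩,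
    .leaf 1 ⟨0, by decide⟩, .leaf 1 ⟨1, by decide⟩, .leaf 1 ⟨2, by decide⟩,
    .leaf 2 ⟨0, by decide⟩, .leaf 2 ⟨1, by decide⟩, .leaf 2 ⟨2, by decide⟩,
    .leaf 2 ⟨3, by decide⟩,
    .leaf 3 ⟨0, by decide⟩, .leaf 3 ⟨1, by decide⟩, .leaf 3 ⟨2, by decide⟩,
    .leaf 3 ⟨3, by decide⟩]

/-- The position of a vertex of `T(19, 4, 4, 2)` in the enumeration `heightTwoVertex`. -/
def heightTwoIndex : HeightTwoVertex 4 4 2 → Fin 19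
  | .root => 0
  | .child i => Fin.ofNat 19 (1 + i)
  | .leaf i j => Fin.ofNat 19 (5 + ![0, 3, 6, 10] i + j)

theorem heightTwoIndex_vertex : Function.LeftInverse heightTwoIndex heightTwoVertex := by
  unfold Function.LeftInverse
  decide +kernel

theorem heightTwoVertex_index : Function.RightInverse heightTwoIndex heightTwoVertex := by
  rintro (_ | i | ⟨i, j, hj⟩)
  · rfl
  · fin_cases i <;> rfl
  · fin_cases i <;> simp at hj <;> interval_cases j <;> rfl

/-- The corresponding enumeration of the vertices of `spider 2 2`. -/
def spiderVertex : Fin 19 → (spider 2 2).Vert :=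
  let s₁ (v : (starTree 3).Vert) : (spider 2 2).Vert := .inl (.inl (.inl (.inr v)))
  let s₂ (v : (starTree 3).Vert) : (spider 2 2).Vert := .inl (.inl (.inr v))
  let s₃ (v : (starTree 4).Vert) : (spider 2 2).Vert := .inl (.inr v)
  let s₄ (v : (starTree 4).Vert) : (spider 2 2).Vert := .inr v
  let l₃ : (starTree 4).Vert := .inl (.inl (.inl (.inr ())))
  let l₂ (k : ℕ) : (starTree (k + 2)).Vert := .inl (.inr ())
  let l₁ : (starTree 3).Vert := .inl (.inl (.inr ()))
  ![root _, s₁ (root _), s₂ (root _), s₃ (root _), s₄ (root _),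
    s₁ l₁, s₁ (l₂ 1), s₁ (.inr ()), s₂ l₁, s₂ (l₂ 1), s₂ (.inr ()),
    s₃ l₃, s₃ (.inl (l₂ 1)), s₃ (l₂ 2), s₃ (.inr ()), s₄ l₃, s₄ (.inl (l₂ 1)), s₄ (l₂ 2), s₄ (.inr ())]

theorem spiderVertex_injective : Function.Injective spiderVertex := by
  unfold Function.Injective
  decide +kernel

theorem heightTwoAdj_vertex : ∀ i j, heightTwoAdj (heightTwoVertex i) (heightTwoVertex j) = true ↔
    (spider 2 2).graph.Adj (spiderVertex i) (spiderVertex j) := by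
  decide +kernel

/-- Both vertex sets are enumerated in the same order, by root, branches and then the leaves of each
branch, so that adjacency can be compared entry by entry. -/
theorem nonempty_iso_heightTwoTree :
    Nonempty (heightTwoTree 4 4 2 ≃g (spider 2 2).graph) := by
  have hcard : Nat.card (Fin 19) = Nat.card (spider 2 2).Vert := by
    rw [card_vert, Nat.card_fin]
    rfl
  let e : Fin 19 ≃ HeightTwoVertex 4 4 2 :=
    ⟨heightTwoVertex, heightTwoIndex, heightTwoIndex_vertex, heightTwoVertex_index⟩
  let f : Fin 19 ≃ (spider 2 2).Vert :=
    .ofBijective spiderVertex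
      ((Nat.bijective_iff_injective_and_card _).2 ⟨spiderVertex_injective, hcard⟩)
  refine ⟨⟨e.symm.trans f, fun {x y} => ?_⟩⟩
  obtain ⟨i, rfl⟩ := e.surjective x
  obtain ⟨j, rfl⟩ := e.surjective y
  rw [heightTwoAdj_iff]
  simp only [Equiv.trans_apply, Equiv.symm_apply_apply]
  exact (heightTwoAdj_vertex i j).symm

theorem numMinimalForts_eq_iff {G : SimpleGraph (Fin 19)} (hG : G.IsTree) :
    numMinimalForts G = 162 ↔ Nonempty (G ≃g heightTwoTree 4 4 2) := by
  obtain ⟨e⟩ := nonempty_iso_heightTwoTree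
  constructor
  · intro h
    obtain ⟨f⟩ := iso_spider_of_numMinimalForts hG (Nat.card_fin 19) h
    exact ⟨f.trans e.symm⟩
  · rintro ⟨f⟩
    rw [numMinimalForts_congr (f.trans e), numMinimalForts_graph]
    rfl

end MinimalForts

theorem mainTheorem6 :
    (∀ n : ℕ, 1 ≤ n → n ≤ 3 → IsGreatest (MinimalForts.treeFortCounts n) 1) ∧
    (∀ n : ℕ, 4 ≤ n → n ≤ 18 →
      IsGreatest (MinimalForts.treeFortCounts n) ((n - 1).choose 2)) ∧
    IsGreatest (MinimalForts.treeFortCounts 19) 162 ∧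
    (∀ G : SimpleGraph (Fin 19), G.IsTree →
      (MinimalForts.numMinimalForts G = 162 ↔
        Nonempty (G ≃g MinimalForts.heightTwoTree 4 4 2))) ∧
    (∀ n : ℕ, 1 ≤ n → n ≤ 4 → IsGreatest (MinimalForts.forestFortCounts n) n) ∧
    (∀ n : ℕ, 5 ≤ n → n ≤ 18 →
      IsGreatest (MinimalForts.forestFortCounts n) ((n - 1).choose 2)) ∧
    IsGreatest (MinimalForts.forestFortCounts 19) 162 := by
  refine ⟨fun n h1 h2 => ?_, fun n h1 h2 => ?_,
    MinimalForts.isGreatest_treeFortCounts (by norm_num) le_rfl,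
    fun G hG => MinimalForts.numMinimalForts_eq_iff hG, fun n h1 h2 => ?_, fun n h1 h2 => ?_,
    MinimalForts.isGreatest_forestFortCounts (by norm_num) le_rfl⟩
  · have h := MinimalForts.isGreatest_treeFortCounts h1 (by omega : n ≤ 19)
    rwa [MinimalForts.treeMax, if_pos h2] at h
  · have h := MinimalForts.isGreatest_treeFortCounts (by omega : 1 ≤ n) (by omega : n ≤ 19)
    rwa [MinimalForts.treeMax, if_neg (by omega), if_pos h2] at h
  · have h := MinimalForts.isGreatest_forestFortCounts h1 (by omega : n ≤ 19)
    rwa [MinimalForts.forestMax, if_pos h2] at h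
  · have h := MinimalForts.isGreatest_forestFortCounts (by omega : 1 ≤ n) (by omega : n ≤ 19)
    rwa [MinimalForts.forestMax, if_neg (by omega), if_pos h2] at h
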